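/- Let $1\le d\le N$. Let $\mathcal O_{N/d}$ be the set of $N\times N$ Hermitian matrices whose eigenvalues, in non-increasing order, are $N/d$ ($d$ times) and $0$ ($N-d$ times). It is a single orbit of $U(N)$ acting by conjugation on Hermitian matrices, and an embedded submanifold of the space of matrices with tangent space $\{[\eta,\xi]:\eta\in\mathfrak u(N)\}$ at $\xi$. Identify a Hermitian matrix $\xi$ with the functional $\alpha_\xi(\eta)=\tfrac{i}{2}\operatorname{tr}(\eta^*\xi)$ on $\mathfrak u(N)$, and equip $\mathcal O_{N/d}$ with the Kirillov–Kostant–Souriau symplectic form $$\omega_\xi([\eta,\xi],[\eta',\xi])=\alpha_\xi([\eta,\eta']).$$ Let $\mathcal F_{N/d}=\{F\in\mathbb C^{d\times N}: FF^*=\tfrac Nd I_d\}$ be the space of $N/d$-tight frames $F=[f_1|\cdots|f_N]$, with $U(d)$ acting by left multiplication and $U(1)^N$ (the diagonal unitary matrices $D$) acting by $D\cdot F=FD^*$. The map $[F]\mapsto F^*F$ identifies $\mathcal F_{N/d}/U(d)$ with $\mathcal O_{N/d}$: it is a homeomorphism; at each $F$ the differential of $F\mapsto F^*F$ maps the tangent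 space $\{X: XF^*+FX^*=0\}$ of $\mathcal F_{N/d}$ onto that of $\mathcal O_{N/d}$, with kernel $\mathfrak u(d)F$; $\omega$ pulls back to the restriction of the standard symplectic form $(X,Y)\mapsto-\operatorname{Im}\operatorname{tr}(Y^*X)$; and the action of $U(1)^N$ corresponds to $D\cdot\xi=D\xi D^*$. The scalars $U(1)\subset U(1)^N$ act trivially on $\mathcal O_{N/d}$. Let $G=U(1)^N/U(1)$, identified with the diagonal unitary matrices whose $(N,N)$ entry is $1$, and identify $\mathfrak g^*$ with $\mathbb R^{N-1}$ by letting $x\in\mathbb R^{N-1}$ be the functional $\operatorname{diag}(i\theta_1,\dots,i\theta_{N-1},0)\mapsto\tfrac12\sum_{k=1}^{N-1}x_k\theta_k$. Then the action of $G$ on the symplectic manifold $(\mathcal O_{N/d},\omega)$ by conjugation, which is effective if $d<N$, is Hamiltonian with momentum map $$\Phi_G:\mathcal O_{N/d}\to\mathbb R^{N-1}\cong\mathfrak g^*,\qquad \Phi_G(F^*F)=(\|f_1\|^2,\dots,\|f_{N-1}\|^2).$$ That is: $\omega$ is a smooth, closed, nondegenerate $2$-form; the action is smooth and preserves $\omega$;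 and for every $v\in\mathfrak g$, with $X^v_p=\frac{d}{dt}\big|_{t=0}\exp(tv)\cdot p$ and $\Phi^v(p)=\Phi_G(p)(v)$, the function $\Phi^v$ is smooth and $\omega(X^v,\cdot)=d\Phi^v$; and $\Phi_G$ is equivariant for the coadjoint action, $\Phi_G(g\cdot p)=\operatorname{Ad}^*_g\Phi_G(p)$. -/

import Mathlib

open scoped Manifold ContDiff Matrix Matrix.Norms.L2Operator

noncomputable section

/-! ### Symplectic manifolds and Hamiltonian actions -/

section Symplectic

variable {E : Type*} [NormedAddCommGroup E] [NormedSpace ℝ E]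
  {M : Type*} [TopologicalSpace M] [ChartedSpace E M]

variable (E M) in
/-- A (not necessarily smooth) differential `2`-form on a manifold `M` modelled on `E`. -/
abbrev TwoForm : Type _ := ∀ p : M, TangentSpace 𝓘(ℝ, E) p [⋀^Fin 2]→L[ℝ] ℝ

/-- The form `Ω` read in the preferred chart at `p`: its pullback along the inverse chart. -/
def TwoForm.inChart (Ω : TwoForm E M) (p : M) (y : E) : E [⋀^Fin 2]→L[ℝ] ℝ :=
  (Ω ((chartAt E p).symm y)).compContinuousLinearMap
    (mfderiv 𝓘(ℝ, E) 𝓘(ℝ, E) (chartAt E p).symm y)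

/-- `(M, Ω)` is a symplectic manifold. -/
structure IsSymplectic (Ω : TwoForm E M) : Prop where
  isManifold : IsManifold 𝓘(ℝ, E) ∞ M
  smooth : ∀ p, ContDiffOn ℝ ∞ (Ω.inChart p) (chartAt E p).target
  closed : ∀ p, ∀ y ∈ (chartAt E p).target, extDeriv (Ω.inChart p) y = 0
  nondegenerate : ∀ (p : M) (X : TangentSpace 𝓘(ℝ, E) p),
    (∀ Y : TangentSpace 𝓘(ℝ, E) p, Ω p ![X, Y] = 0) → X = 0

variable {E' H' G : Type*} [NormedAddCommGroup E'] [NormedSpace ℝ E'] [TopologicalSpace H']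
  (I : ModelWithCorners ℝ E' H') [Group G] [TopologicalSpace G] [ChartedSpace H' G]

/-- The adjoint action of `g` on the Lie algebra: the differential at `1` of `h ↦ g h g⁻¹`. -/
def lieAd (g : G) (v : GroupLieAlgebra I G) : GroupLieAlgebra I G :=
  (mfderiv I I (fun h : G => g * h * g⁻¹) 1 v : E')

variable [MulAction G M]

/-- The vector field on `M` generated by `v` in the Lie algebra: at `p` it is the differential at
`1` of `g ↦ g • p`, applied to `v`, that is, `d/dt (exp (t v) • p)` at `t = 0`. -/
def fundamentalField (v : GroupLieAlgebra I G) (p : M) : TangentSpace 𝓘(ℝ, E) p :=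
  (mfderiv I 𝓘(ℝ, E) (fun g : G => g • p) 1 v : E)

/-- The action of the Lie group `G` on the symplectic manifold `(M, Ω)` is Hamiltonian with
momentum map `Φ`. -/
structure IsHamiltonianAction [LieGroup I ∞ G] (Ω : TwoForm E M)
    (Φ : M → (GroupLieAlgebra I G →L[ℝ] ℝ)) : Prop where
  isSymplectic : IsSymplectic Ω
  smooth_smul : ContMDiffSMul I 𝓘(ℝ, E) ∞ G M
  invariant : ∀ (g : G) (p : M) (X Y : TangentSpace 𝓘(ℝ, E) p),
    Ω (g • p) ![mfderiv 𝓘(ℝ, E) 𝓘(ℝ, E) (fun q : M => g • q) p X,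
      mfderiv 𝓘(ℝ, E) 𝓘(ℝ, E) (fun q : M => g • q) p Y] = Ω p ![X, Y]
  smooth_momentum : ∀ v, ContMDiff 𝓘(ℝ, E) 𝓘(ℝ, ℝ) ∞ (fun p => Φ p v)
  hamilton : ∀ (v : GroupLieAlgebra I G) (p : M) (Y : TangentSpace 𝓘(ℝ, E) p),
    Ω p ![fundamentalField I v p, Y] = (mfderiv 𝓘(ℝ, E) 𝓘(ℝ, ℝ) (fun q => Φ q v) p Y : ℝ)
  equivariant : ∀ (g : G) (p : M) (v : GroupLieAlgebra I G), Φ (g • p) v = Φ p (lieAd I g⁻¹ v)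

end Symplectic

/-! ### Tori as Lie groups -/

section Torus
variable {ι : Type} [Fintype ι]
/-- The model with corners of the torus `U(1)^ι`. -/
abbrev torusModel (ι : Type) [Fintype ι] :=
  ModelWithCorners.pi (fun _ : ι => 𝓡 1)

theorem contMDiff_torus_iff {E H M : Type*} [NormedAddCommGroup E] [NormedSpace ℝ E]
    [TopologicalSpace H] {I : ModelWithCorners ℝ E H} [TopologicalSpace M] [ChartedSpace H M]
    {f : M → ι → Circle} :
    ContMDiff I (torusModel ι) ∞ f ↔ ∀ i, ContMDiff I (𝓡 1) ∞ (fun x => f x i) := by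
  simp only [ContMDiff]
  rw [forall_comm]
  refine forall_congr' fun x => ?_
  simp only [contMDiffAt_iff, continuousAt_pi, forall_and]
  refine and_congr Iff.rfl ?_
  rw [contDiffWithinAt_pi]
  rfl

instance : IsManifold (torusModel ι) ∞ (ι → Circle) := by
  apply isManifold_of_contDiffOn
  rintro e e' ⟨f, hf, rfl⟩ ⟨f', hf', rfl⟩
  rw [contDiffOn_pi]
  intro i
  have h := (contDiffGroupoid ∞ (𝓡 1)).compatible (hf i trivial) (hf' i trivial)
  rw [contDiffGroupoid, mem_groupoid_of_pregroupoid] at h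
  have h1 : ContDiffOn ℝ ∞ _ _ := h.1
  refine h1.comp (contDiff_apply ℝ _ i).contDiffOn ?_
  rintro x ⟨hx, -⟩
  refine ⟨?_, by simp⟩
  have hx1 := hx.1
  have hx2 := hx.2
  exact ⟨hx1 i trivial, hx2 i trivial⟩

theorem contMDiff_torus_apply (i : ι) :
    ContMDiff (torusModel ι) (𝓡 1) ∞ (fun g : ι → Circle => g i) :=
  contMDiff_torus_iff.1 contMDiff_id i

instance : LieGroup (torusModel ι) ∞ (ι → Circle) where
  contMDiff_mul := contMDiff_torus_iff.2 fun i =>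
    ((contMDiff_torus_apply i).comp contMDiff_fst).mul ((contMDiff_torus_apply i).comp contMDiff_snd)
  contMDiff_inv := contMDiff_torus_iff.2 fun i => (contMDiff_torus_apply i).inv
end Torus

/-! ### The orbit as a manifold -/

/-- `ξ` is Hermitian and its eigenvalues, in non-increasing order, are `N / d` (the first `d` of
them) and `0` (the remaining ones). -/
def IsOrbitMatrix (d N : ℕ) (ξ : Matrix (Fin N) (Fin N) ℂ) : Prop :=
  ∃ h : ξ.IsHermitian, ∀ i, h.eigenvalues₀ i = if (i : ℕ) < d then (N : ℝ) / d else 0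

theorem step_of_antitone {m d : ℕ} {c : ℝ} (hc : 0 < c) (f : Fin m → ℝ) (hf : Antitone f)
    (h01 : ∀ i, f i = 0 ∨ f i = c) (hs : ∑ i, f i = d * c) (i : Fin m) :
    f i = if (i : ℕ) < d then c else 0 := by
  classical
  set S := Finset.univ.filter (fun i => f i = c) with hS
  have hcard : S.card = d := by
    have h1 : ∑ i, f i = ∑ i, if f i = c then c else 0 := by
      refine Finset.sum_congr rfl fun i _ => ?_
      rcases h01 i with h | h <;> simp [h, hc.ne]
    rw [h1, ← Finset.sum_filter, Finset.sum_const, nsmul_eq_mul] at hs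
    exact_mod_cast mul_right_cancel₀ hc.ne' hs
  rcases h01 i with h | h
  · have : S ⊆ Finset.Iio i := by
      intro j hj
      rw [Finset.mem_Iio]
      by_contra hij
      have := hf (not_lt.1 hij)
      simp [hS] at hj
      linarith
    have := Finset.card_le_card this
    rw [hcard, Fin.card_Iio] at this
    simp [h, not_lt.2 this]
  · have : Finset.Iic i ⊆ S := by
      intro j hj
      have := hf (Finset.mem_Iic.1 hj)
      rcases h01 j with h' | h'
      · linarith
      · simp [hS, h']
    have := Finset.card_le_card this
    rw [hcard, Fin.card_Iic] at this
    simp [h, Nat.lt_of_succ_le this]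

theorem isOrbitMatrix_iff {d N : ℕ} (hd : 0 < d) (hN : d ≤ N) (ξ : Matrix (Fin N) (Fin N) ℂ) :
    IsOrbitMatrix d N ξ ↔
      ξ.IsHermitian ∧ ξ * ξ = ((N : ℂ) / d) • ξ ∧ ξ.trace = N := by
  have hc : 0 < (N : ℝ) / d := by
    have : 0 < N := by omega
    positivity
  have hsum : ∀ h : ξ.IsHermitian, ∑ i, h.eigenvalues i = ∑ i, h.eigenvalues₀ i := fun h =>
    Equiv.sum_comp (Fintype.equivOfCardEq (Fintype.card_fin _)).symm h.eigenvalues₀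
  constructor
  · rintro ⟨h, he⟩
    have he' : ∀ i, h.eigenvalues i = 0 ∨ h.eigenvalues i = N / d := by
      intro i
      simp only [Matrix.IsHermitian.eigenvalues, he]
      split_ifs <;> simp
    refine ⟨h, ?_, ?_⟩
    · have hs := h.spectral_theorem
      generalize hV : Unitary.conjStarAlgAut ℂ (Matrix (Fin N) (Fin N) ℂ) h.eigenvectorUnitary = φ
        at hs
      conv_lhs => rw [hs]
      conv_rhs => rw [hs]
      rw [← map_mul, ← map_smul, Matrix.diagonal_mul_diagonal, ← Matrix.diagonal_smul]
      congr 2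
      ext i
      rcases he' i with h | h <;> simp [h]
    · rw [h.trace_eq_sum_eigenvalues]
      have : ∑ i, h.eigenvalues i = N := by
        rw [hsum, Finset.sum_congr rfl fun i _ => he i, ← Finset.sum_filter, Finset.sum_const]
        have : (Finset.univ.filter fun i : Fin (Fintype.card (Fin N)) => (i : ℕ) < d).card = d := by
          rw [Fin.card_filter_val_lt]; simp [hN]
        rw [this, nsmul_eq_mul]
        field_simp
      rw [← RCLike.ofReal_sum, this]
      simp
  · rintro ⟨h, h2, ht⟩
    refine ⟨h, step_of_antitone hc _ h.eigenvalues₀_antitone ?_ ?_⟩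
    · suffices ∀ i, h.eigenvalues i = 0 ∨ h.eigenvalues i = N / d by
        intro i
        simpa [Matrix.IsHermitian.eigenvalues] using
          this (Fintype.equivOfCardEq (Fintype.card_fin _) i)
      intro i
      have hv := h.mulVec_eigenvectorBasis i
      set v := (h.eigenvectorBasis i).ofLp with hvdef
      have h3 : (ξ * ξ) *ᵥ v = (((N : ℂ) / d) • ξ) *ᵥ v := by rw [h2]
      rw [← Matrix.mulVec_mulVec, Matrix.smul_mulVec, hv, Matrix.mulVec_smul, hv] at h3
      have hv0 : v ≠ 0 := by
        intro h0
        have := h.eigenvectorBasis.orthonormal.ne_zero i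
        apply this
        ext k
        exact congrFun h0 k
      obtain ⟨k, hk⟩ := Function.ne_iff.1 hv0
      have h4 := congrFun h3 k
      simp at h4 hk
      rcases h4 with h4 | h4 | h4
      · exact Or.inr (by simpa using congrArg Complex.re h4)
      · exact Or.inl h4
      · exact absurd h4 hk
    · rw [← hsum]
      have := h.trace_eq_sum_eigenvalues
      rw [ht] at this
      have : (N : ℝ) = ∑ i, h.eigenvalues i := by
        rw [← RCLike.ofReal_sum] at this
        simpa using congrArg Complex.re this
      rw [← this]
      field_simp

/-- The orbit `𝒪_{N/d}`, with the topology of a subspace of the `N × N` matrices. -/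
def Orbit (d N : ℕ) : Type := {ξ : Matrix (Fin N) (Fin N) ℂ // IsOrbitMatrix d N ξ}

namespace Orbit
variable {d N : ℕ}
/-- The inclusion of `𝒪_{N/d}` into the space of matrices. -/
def incl (ξ : Orbit d N) : Matrix (Fin N) (Fin N) ℂ := ξ.1

instance : TopologicalSpace (Orbit d N) := instTopologicalSpaceSubtype

theorem continuous_incl : Continuous (incl : Orbit d N → _) := continuous_subtype_val

end Orbit

/-- An orthonormal basis of `ℂ^N`, the columns of `A` (the first `d` vectors) and of `B` (the other
`N - d`). Each one gives a chart of `𝒪_{N/d}`. -/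
structure Splitting (d N : ℕ) where
  A : Matrix (Fin N) (Fin d) ℂ
  B : Matrix (Fin N) (Fin (N - d)) ℂ
  hAA : Aᴴ * A = 1
  hBB : Bᴴ * B = 1
  hAB : Aᴴ * B = 0
  hsum : A * Aᴴ + B * Bᴴ = 1

/-- The real vector space on which `𝒪_{N/d}` is modelled. -/
abbrev OrbitModel (d N : ℕ) : Type := Matrix (Fin (N - d)) (Fin d) ℂ

namespace Splitting
variable {d N : ℕ}
theorem hBA (s : Splitting d N) : s.Bᴴ * s.A = 0 := by
  simpa using congrArg Matrix.conjTranspose s.hAB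

theorem exists_of_isOrbitMatrix (hN : d ≤ N) {ξ : Matrix (Fin N) (Fin N) ℂ}
    (hξ : IsOrbitMatrix d N ξ) : ∃ s : Splitting d N, ξ = ((N : ℂ) / d) • (s.A * s.Aᴴ) := by
  obtain ⟨h, he⟩ := hξ
  let e₀ : Fin d ⊕ Fin (N - d) ≃ Fin (Fintype.card (Fin N)) :=
    finSumFinEquiv.trans (finCongr (by simp; omega))
  let σ : Fin d ⊕ Fin (N - d) ≃ Fin N := e₀.trans (Fintype.equivOfCardEq (Fintype.card_fin _))
  have hl : ∀ i, h.eigenvalues (σ (Sum.inl i)) = N / d := by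
    intro i; simp [Matrix.IsHermitian.eigenvalues, σ, he, e₀]
  have hr : ∀ i, h.eigenvalues (σ (Sum.inr i)) = 0 := by
    intro i; simp [Matrix.IsHermitian.eigenvalues, σ, he, e₀]
  let U : Matrix (Fin N) (Fin N) ℂ := h.eigenvectorUnitary
  have hU1 : Uᴴ * U = 1 := Unitary.coe_star_mul_self h.eigenvectorUnitary
  have hU2 : U * Uᴴ = 1 := Unitary.coe_mul_star_self h.eigenvectorUnitary
  let A : Matrix (Fin N) (Fin d) ℂ := U.submatrix id (fun i => σ (Sum.inl i))
  let B : Matrix (Fin N) (Fin (N - d)) ℂ := U.submatrix id (fun i => σ (Sum.inr i))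
  have hsum : ∀ f : Fin N → ℂ, ∑ k, f k = ∑ i, f (σ (Sum.inl i)) + ∑ i, f (σ (Sum.inr i)) := by
    intro f
    rw [← Equiv.sum_comp σ, Fintype.sum_sum_type]
  refine ⟨⟨A, B, ?_, ?_, ?_, ?_⟩, ?_⟩
  · ext i j
    have := congrFun (congrFun hU1 (σ (Sum.inl i))) (σ (Sum.inl j))
    simpa [Matrix.mul_apply, A, Matrix.one_apply] using this
  · ext i j
    have := congrFun (congrFun hU1 (σ (Sum.inr i))) (σ (Sum.inr j))
    simpa [Matrix.mul_apply, B, Matrix.one_apply] using this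
  · ext i j
    have := congrFun (congrFun hU1 (σ (Sum.inl i))) (σ (Sum.inr j))
    simpa [Matrix.mul_apply, A, B, Matrix.one_apply] using this
  · ext i j
    have := congrFun (congrFun hU2 i) j
    rw [Matrix.mul_apply, hsum] at this
    simpa [Matrix.mul_apply, A, B] using this
  · ext i j
    have := congrFun (congrFun h.spectral_theorem i) j
    rw [Unitary.conjStarAlgAut_apply, Matrix.mul_apply, hsum] at this
    simp only [Matrix.mul_diagonal, Function.comp, hl, hr] at this
    rw [this]
    simp only [Matrix.smul_apply, Matrix.mul_apply, A, U, smul_eq_mul, Finset.mul_sum]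
    simp
    refine Finset.sum_congr rfl fun k _ => by ring

/-- The columns of `A + B Z` span the graph of `Z : span A → span B`. -/
def graphFrame (s : Splitting d N) (Z : Matrix (Fin (N - d)) (Fin d) ℂ) :
    Matrix (Fin N) (Fin d) ℂ := s.A + s.B * Z

/-- `N / d` times the orthogonal projection onto the graph of `Z`. -/
def graphMatrix (s : Splitting d N) (Z : Matrix (Fin (N - d)) (Fin d) ℂ) :
    Matrix (Fin N) (Fin N) ℂ :=
  ((N : ℂ) / d) • (s.graphFrame Z * (1 + Zᴴ * Z)⁻¹ * (s.graphFrame Z)ᴴ)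

/-- The matrix `Z` such that the range of `ξ` is the graph of `Z`, whenever `Aᴴ ξ A` is
invertible. -/
def coord (s : Splitting d N) (ξ : Matrix (Fin N) (Fin N) ℂ) :
    Matrix (Fin (N - d)) (Fin d) ℂ :=
  (s.Bᴴ * ξ * s.A) * (s.Aᴴ * ξ * s.A)⁻¹

theorem graphFrame_gram (s : Splitting d N) (Z : Matrix (Fin (N - d)) (Fin d) ℂ) :
    (s.graphFrame Z)ᴴ * s.graphFrame Z = 1 + Zᴴ * Z := by
  simp only [graphFrame, Matrix.conjTranspose_add, Matrix.conjTranspose_mul, Matrix.add_mul,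
    Matrix.mul_add, s.hAA]
  rw [Matrix.mul_assoc Zᴴ, s.hBA, ← Matrix.mul_assoc s.Aᴴ, s.hAB, Matrix.mul_assoc Zᴴ,
    ← Matrix.mul_assoc s.Bᴴ, s.hBB]
  simp

theorem A_graphFrame (s : Splitting d N) (Z : Matrix (Fin (N - d)) (Fin d) ℂ) :
    s.Aᴴ * s.graphFrame Z = 1 := by
  rw [graphFrame, Matrix.mul_add, s.hAA, ← Matrix.mul_assoc, s.hAB]; simp

theorem B_graphFrame (s : Splitting d N) (Z : Matrix (Fin (N - d)) (Fin d) ℂ) :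
    s.Bᴴ * s.graphFrame Z = Z := by
  rw [graphFrame, Matrix.mul_add, s.hBA, ← Matrix.mul_assoc, s.hBB]; simp

open scoped ComplexOrder in
theorem isUnit_gram (Z : Matrix (Fin (N - d)) (Fin d) ℂ) : IsUnit (1 + Zᴴ * Z).det := by
  rw [← Matrix.isUnit_iff_isUnit_det]
  exact (Matrix.PosDef.one.add_posSemidef (Matrix.posSemidef_conjTranspose_mul_self Z)).isUnit

theorem scale_ne_zero (hd : 0 < d) (hN : d ≤ N) : (N : ℂ) / d ≠ 0 := by
  have h1 : (N : ℂ) ≠ 0 := by exact_mod_cast (by omega : N ≠ 0)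
  have h2 : (d : ℂ) ≠ 0 := by exact_mod_cast hd.ne'
  exact div_ne_zero h1 h2

theorem isOrbitMatrix_graphMatrix (hd : 0 < d) (hN : d ≤ N) (s : Splitting d N)
    (Z : Matrix (Fin (N - d)) (Fin d) ℂ) : IsOrbitMatrix d N (s.graphMatrix Z) := by
  have hd' : (d : ℂ) ≠ 0 := by exact_mod_cast hd.ne'
  have hu := isUnit_gram Z
  have hg := s.graphFrame_gram Z
  have hK : ((1 + Zᴴ * Z)⁻¹)ᴴ = (1 + Zᴴ * Z)⁻¹ := by
    rw [Matrix.conjTranspose_nonsing_inv]; simp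
  rw [isOrbitMatrix_iff hd hN, graphMatrix]
  generalize s.graphFrame Z = W at *
  generalize 1 + Zᴴ * Z = K at *
  refine ⟨?_, ?_, ?_⟩
  · rw [Matrix.IsHermitian, Matrix.conjTranspose_smul]
    simp [Matrix.conjTranspose_mul, hK, Matrix.mul_assoc]
  · rw [Matrix.smul_mul, Matrix.mul_smul]
    congr 2
    calc W * K⁻¹ * Wᴴ * (W * K⁻¹ * Wᴴ) = W * K⁻¹ * ((Wᴴ * W) * K⁻¹) * Wᴴ := by
          simp only [Matrix.mul_assoc]
      _ = _ := by rw [hg, Matrix.mul_nonsing_inv _ hu, Matrix.mul_one]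
  · rw [Matrix.trace_smul, Matrix.trace_mul_comm, ← Matrix.mul_assoc, hg,
      Matrix.mul_nonsing_inv _ hu, Matrix.trace_one]
    simp
    field_simp

theorem coord_graphMatrix (hd : 0 < d) (hN : d ≤ N) (s : Splitting d N)
    (Z : Matrix (Fin (N - d)) (Fin d) ℂ) :
    IsUnit (s.Aᴴ * s.graphMatrix Z * s.A).det ∧ s.coord (s.graphMatrix Z) = Z := by
  have hc := scale_ne_zero hd hN
  have hu := isUnit_gram Z
  have hA := s.A_graphFrame Z
  have hB := s.B_graphFrame Z
  have hA' : (s.graphFrame Z)ᴴ * s.A = 1 := by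
    simpa using congrArg Matrix.conjTranspose hA
  have e1 : s.Aᴴ * s.graphMatrix Z * s.A = ((N : ℂ) / d) • (1 + Zᴴ * Z)⁻¹ := by
    rw [graphMatrix, Matrix.mul_smul, Matrix.smul_mul]
    congr 1
    rw [Matrix.mul_assoc, Matrix.mul_assoc _ _ s.A, hA', ← Matrix.mul_assoc, ← Matrix.mul_assoc, hA]
    simp
  have e2 : s.Bᴴ * s.graphMatrix Z * s.A = ((N : ℂ) / d) • (Z * (1 + Zᴴ * Z)⁻¹) := by
    rw [graphMatrix, Matrix.mul_smul, Matrix.smul_mul]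
    congr 1
    rw [Matrix.mul_assoc, Matrix.mul_assoc _ _ s.A, hA', ← Matrix.mul_assoc, ← Matrix.mul_assoc, hB]
    simp
  have hu2 : IsUnit (((N : ℂ) / d) • (1 + Zᴴ * Z)⁻¹).det := by
    rw [Matrix.det_smul]
    exact (IsUnit.mk0 _ (pow_ne_zero _ hc)).mul (Matrix.isUnit_nonsing_inv_det _ hu)
  refine ⟨e1 ▸ hu2, ?_⟩
  rw [coord, e1, e2, ← Matrix.mul_smul, Matrix.mul_assoc, Matrix.mul_nonsing_inv _ hu2,
    Matrix.mul_one]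

open scoped ComplexOrder in
theorem graphMatrix_coord (hd : 0 < d) (hN : d ≤ N) (s : Splitting d N)
    {ξ : Matrix (Fin N) (Fin N) ℂ} (hξ : IsOrbitMatrix d N ξ)
    (hu : IsUnit (s.Aᴴ * ξ * s.A).det) : s.graphMatrix (s.coord ξ) = ξ := by
  obtain ⟨hH, h2, ht⟩ := (isOrbitMatrix_iff hd hN ξ).1 hξ
  have hc := scale_ne_zero hd hN
  have hd' : (d : ℂ) ≠ 0 := by exact_mod_cast hd.ne'
  set c : ℂ := (N : ℂ) / d with hcdef
  set L := s.Aᴴ * ξ * s.A with hL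
  have hLH : (L⁻¹)ᴴ = L⁻¹ := by
    rw [Matrix.conjTranspose_nonsing_inv]
    congr 1
    simp [hL, hH.eq, Matrix.mul_assoc]
  have hW : s.graphFrame (s.coord ξ) = ξ * s.A * L⁻¹ := by
    have h1 : s.A * L = s.A * s.Aᴴ * (ξ * s.A) := by simp [hL, Matrix.mul_assoc]
    have h2 : s.A = s.A * s.Aᴴ * (ξ * s.A) * L⁻¹ := by
      rw [← h1, Matrix.mul_assoc, Matrix.mul_nonsing_inv _ hu, Matrix.mul_one]
    rw [graphFrame]
    conv_lhs => enter [1]; rw [h2]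
    have h3 : s.B * s.coord ξ = s.B * s.Bᴴ * (ξ * s.A) * L⁻¹ := by
      simp only [coord, hL, Matrix.mul_assoc]
    rw [h3, ← Matrix.add_mul, ← Matrix.add_mul, s.hsum, Matrix.one_mul]
  have hK : 1 + (s.coord ξ)ᴴ * s.coord ξ = c • L⁻¹ := by
    rw [← s.graphFrame_gram, hW]
    simp only [Matrix.conjTranspose_mul, hLH, hH.eq]
    calc L⁻¹ * (s.Aᴴ * ξ) * (ξ * s.A * L⁻¹) = L⁻¹ * (s.Aᴴ * (ξ * ξ) * s.A) * L⁻¹ := by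
          simp only [Matrix.mul_assoc]
      _ = c • (L⁻¹ * L * L⁻¹) := by
          rw [h2]; simp only [hL, Matrix.mul_smul, Matrix.smul_mul]
      _ = _ := by rw [Matrix.nonsing_inv_mul _ hu, Matrix.one_mul]
  have hKi : (c • L⁻¹)⁻¹ = c⁻¹ • L := by
    apply Matrix.inv_eq_right_inv
    rw [Matrix.smul_mul, Matrix.mul_smul, smul_smul, mul_inv_cancel₀ hc, one_smul,
      Matrix.nonsing_inv_mul _ hu]
  have hR : s.graphMatrix (s.coord ξ) = ξ * s.A * L⁻¹ * (s.Aᴴ * ξ) := by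
    rw [graphMatrix, hK, hKi, hW]
    simp only [Matrix.conjTranspose_mul, hLH, hH.eq, Matrix.mul_smul, Matrix.smul_mul, smul_smul,
      ← hcdef, mul_inv_cancel₀ hc, one_smul]
    rw [Matrix.mul_assoc _ L⁻¹ L, Matrix.nonsing_inv_mul _ hu, Matrix.mul_one, ← Matrix.mul_assoc]
  rw [hR]
  set R := ξ * s.A * L⁻¹ * (s.Aᴴ * ξ) with hRdef
  have hRH : Rᴴ = R := by
    simp [hRdef, Matrix.conjTranspose_mul, hLH, hH.eq, Matrix.mul_assoc]
  have hξR : ξ * R = c • R := by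
    rw [hRdef]
    simp only [← Matrix.mul_assoc]
    rw [h2]
    simp only [Matrix.smul_mul]
  have hRξ : R * ξ = c • R := by
    have h := congrArg Matrix.conjTranspose hξR
    rw [Matrix.conjTranspose_mul, hRH, hH.eq, Matrix.conjTranspose_smul, hRH] at h
    rw [h]
    simp [c]
  have hRR : R * R = c • R := by
    calc R * R = ξ * s.A * L⁻¹ * (s.Aᴴ * (ξ * R)) := by
          conv_lhs => enter [1]; rw [hRdef]
          simp only [Matrix.mul_assoc]
      _ = c • (ξ * s.A * L⁻¹ * (s.Aᴴ * R)) := by rw [hξR]; simp only [Matrix.mul_smul]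
      _ = c • (ξ * s.A * (L⁻¹ * L) * L⁻¹ * (s.Aᴴ * ξ)) := by
          rw [hRdef, hL]; simp only [Matrix.mul_assoc]
      _ = c • R := by rw [Matrix.nonsing_inv_mul _ hu, Matrix.mul_one]
  have htr : R.trace = N := by
    rw [hRdef, Matrix.trace_mul_comm]
    have : s.Aᴴ * ξ * (ξ * s.A * L⁻¹) = c • 1 := by
      calc s.Aᴴ * ξ * (ξ * s.A * L⁻¹) = s.Aᴴ * (ξ * ξ) * s.A * L⁻¹ := by
            simp only [Matrix.mul_assoc]
        _ = c • (L * L⁻¹) := by rw [h2]; simp only [hL, Matrix.mul_smul, Matrix.smul_mul]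
        _ = _ := by rw [Matrix.mul_nonsing_inv _ hu]
    rw [this, Matrix.trace_smul, Matrix.trace_one]
    simp [c]
    field_simp
  have h0 : ((R - ξ)ᴴ * (R - ξ)).trace = 0 := by
    have : (R - ξ)ᴴ * (R - ξ) = c • (ξ - R) := by
      rw [Matrix.conjTranspose_sub, hRH, hH.eq, Matrix.sub_mul, Matrix.mul_sub, Matrix.mul_sub,
        hRR, hRξ, hξR, h2, smul_sub]
      abel
    rw [this, Matrix.trace_smul, Matrix.trace_sub, htr, ht]
    simp
  exact sub_eq_zero.1 (Matrix.trace_conjTranspose_mul_self_eq_zero_iff.1 h0)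

theorem continuousOn_matrix_inv {X : Type*} [TopologicalSpace X] {m : ℕ} {f : X → Matrix (Fin m) (Fin m) ℂ}
    {t : Set X} (hf : ContinuousOn f t) (hu : ∀ x ∈ t, IsUnit (f x).det) :
    ContinuousOn (fun x => (f x)⁻¹) t := by
  have hdet : ContinuousOn (fun x => (f x).det) t :=
    (Continuous.matrix_det continuous_id).comp_continuousOn hf
  have hadj : ContinuousOn (fun x => (f x).adjugate) t :=
    (Continuous.matrix_adjugate continuous_id).comp_continuousOn hf
  simp only [Matrix.inv_def, Ring.inverse_eq_inv']
  exact (hdet.inv₀ fun x hx => (hu x hx).ne_zero).smul hadj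

theorem continuousOn_coord (s : Splitting d N) :
    ContinuousOn s.coord {ξ : Matrix (Fin N) (Fin N) ℂ | (s.Aᴴ * ξ * s.A).det ≠ 0} := by
  have h1 : Continuous fun ξ : Matrix (Fin N) (Fin N) ℂ => s.Aᴴ * ξ * s.A :=
    (continuous_const.matrix_mul continuous_id).matrix_mul continuous_const
  have h2 : Continuous fun ξ : Matrix (Fin N) (Fin N) ℂ => s.Bᴴ * ξ * s.A :=
    (continuous_const.matrix_mul continuous_id).matrix_mul continuous_const
  have h3 : ContinuousOn (fun ξ : Matrix (Fin N) (Fin N) ℂ => (s.Aᴴ * ξ * s.A)⁻¹)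
      {ξ : Matrix (Fin N) (Fin N) ℂ | (s.Aᴴ * ξ * s.A).det ≠ 0} :=
    continuousOn_matrix_inv h1.continuousOn (fun ξ hξ => IsUnit.mk0 _ hξ)
  rw [continuousOn_iff_continuous_domRestrict] at h3 ⊢
  exact (h2.comp continuous_subtype_val).matrix_mul h3

theorem continuous_graphMatrix (s : Splitting d N) : Continuous s.graphMatrix := by
  have hW : Continuous s.graphFrame :=
    continuous_const.add (continuous_const.matrix_mul continuous_id)
  have hK : Continuous fun Z : Matrix (Fin (N - d)) (Fin d) ℂ => 1 + Zᴴ * Z :=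
    continuous_const.add (continuous_id.matrix_conjTranspose.matrix_mul continuous_id)
  have hKi := continuousOn_univ.1
    (continuousOn_matrix_inv hK.continuousOn (t := Set.univ) fun Z _ => isUnit_gram Z)
  exact ((hW.matrix_mul hKi).matrix_mul hW.matrix_conjTranspose).const_smul ((N : ℂ) / d)

/-- The graph chart of `𝒪_{N/d}` belonging to a splitting; it is onto the space of
`(N - d) × d` matrices. -/
def chart [hd : Fact (0 < d)] [hN : Fact (d ≤ N)] (s : Splitting d N) :
    OpenPartialHomeomorph (Orbit d N) (Matrix (Fin (N - d)) (Fin d) ℂ) where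
  toFun ξ := s.coord ξ.incl
  invFun Z := ⟨s.graphMatrix Z, isOrbitMatrix_graphMatrix hd.out hN.out s Z⟩
  source := {ξ | (s.Aᴴ * ξ.incl * s.A).det ≠ 0}
  target := Set.univ
  map_source' _ _ := trivial
  map_target' Z _ := (coord_graphMatrix hd.out hN.out s Z).1.ne_zero
  left_inv' ξ hξ := Subtype.ext (graphMatrix_coord hd.out hN.out s ξ.2 (IsUnit.mk0 _ hξ))
  right_inv' Z _ := (coord_graphMatrix hd.out hN.out s Z).2
  open_source := by
    refine isOpen_ne_fun (Continuous.matrix_det ?_) continuous_const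
    exact (continuous_const.matrix_mul Orbit.continuous_incl).matrix_mul continuous_const
  open_target := isOpen_univ
  continuousOn_toFun := by
    exact s.continuousOn_coord.comp Orbit.continuous_incl.continuousOn fun _ h => h
  continuousOn_invFun := by
    exact (s.continuous_graphMatrix.subtype_mk _).continuousOn

end Splitting

namespace Orbit
variable {d N : ℕ}
/-- A splitting adapted to `ξ`: the columns of `A` span the range of `ξ`. -/
def splittingAt [hN : Fact (d ≤ N)] (ξ : Orbit d N) : Splitting d N :=
  (Splitting.exists_of_isOrbitMatrix hN.out ξ.2).choose

theorem splittingAt_spec [hN : Fact (d ≤ N)] (ξ : Orbit d N) :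
    ξ.incl = ((N : ℂ) / d) • (ξ.splittingAt.A * ξ.splittingAt.Aᴴ) :=
  (Splitting.exists_of_isOrbitMatrix hN.out ξ.2).choose_spec

/-- The atlas of all graph charts. -/
instance [hd : Fact (0 < d)] [hN : Fact (d ≤ N)] : ChartedSpace (OrbitModel d N) (Orbit d N) where
  atlas := Set.range Splitting.chart
  chartAt ξ := ξ.splittingAt.chart
  mem_chart_source ξ := by
    have hc := Splitting.scale_ne_zero hd.out hN.out
    change (_ : ℂ) ≠ 0
    rw [splittingAt_spec ξ, Matrix.mul_smul, Matrix.smul_mul, ← Matrix.mul_assoc,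
      ξ.splittingAt.hAA, Matrix.one_mul, ξ.splittingAt.hAA, Matrix.det_smul, Matrix.det_one, mul_one]
    exact pow_ne_zero _ hc
  chart_mem_atlas ξ := ⟨_, rfl⟩
end Orbit

/-! ### The Kirillov–Kostant–Souriau form -/

/-- The pairing `α_ξ(η) = (i / 2) tr (ηᴴ ξ)` of a Hermitian matrix `ξ` with a skew-Hermitian `η`
(a real number for such `ξ` and `η`), which identifies Hermitian matrices with `𝔲(N)*`. -/
def alphaPairing {N : ℕ} (ξ η : Matrix (Fin N) (Fin N) ℂ) : ℝ :=
  (Complex.I / 2 * (ηᴴ * ξ).trace).re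

namespace Orbit

variable {d N : ℕ}

/-- For `X` tangent to the orbit at `ξ`, this is a skew-Hermitian `η` with `⁅η, ξ⁆ = X`. -/
def lift (ξ : Orbit d N) (X : Matrix (Fin N) (Fin N) ℂ) : Matrix (Fin N) (Fin N) ℂ :=
  ((d : ℝ) / N) ^ 2 • ⁅X, ξ.incl⁆

theorem continuous_lift (ξ : Orbit d N) : Continuous ξ.lift := by
  unfold lift
  simp only [Ring.lie_def]
  exact ((continuous_id.matrix_mul continuous_const).sub
    (continuous_const.matrix_mul continuous_id)).const_smul (((d : ℝ) / N) ^ 2)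

theorem lift_add (ξ : Orbit d N) (X Y : Matrix (Fin N) (Fin N) ℂ) :
    ξ.lift (X + Y) = ξ.lift X + ξ.lift Y := by
  simp only [lift, Ring.lie_def, Matrix.add_mul, Matrix.mul_add, ← smul_add]
  congr 1
  abel

theorem lift_smul (ξ : Orbit d N) (c : ℝ) (X : Matrix (Fin N) (Fin N) ℂ) :
    ξ.lift (c • X) = c • ξ.lift X := by
  simp only [lift, Ring.lie_def, Matrix.smul_mul, Matrix.mul_smul, ← smul_sub]
  rw [smul_comm]

theorem alphaPairing_add (ξ η η' : Matrix (Fin N) (Fin N) ℂ) :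
    alphaPairing ξ (η + η') = alphaPairing ξ η + alphaPairing ξ η' := by
  simp only [alphaPairing, Matrix.conjTranspose_add, Matrix.add_mul, Matrix.trace_add, mul_add,
    Complex.add_re]

theorem alphaPairing_smul (ξ η : Matrix (Fin N) (Fin N) ℂ) (c : ℝ) :
    alphaPairing ξ (c • η) = c • alphaPairing ξ η := by
  simp only [alphaPairing, Matrix.conjTranspose_smul, Matrix.smul_mul, Matrix.trace_smul,
    star_trivial, mul_smul_comm, Complex.smul_re]

theorem smul_lie_matrix (X Y : Matrix (Fin N) (Fin N) ℂ) (c : ℝ) : ⁅c • X, Y⁆ = c • ⁅X, Y⁆ := by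
  simp only [Ring.lie_def, Matrix.smul_mul, Matrix.mul_smul, ← smul_sub]

theorem lie_smul_matrix (X Y : Matrix (Fin N) (Fin N) ℂ) (c : ℝ) : ⁅X, c • Y⁆ = c • ⁅X, Y⁆ := by
  simp only [Ring.lie_def, Matrix.smul_mul, Matrix.mul_smul, ← smul_sub]

/-- The alternating form `(X, Y) ↦ α_ξ(⁅η_X, η_Y⁆)`, where `η_X` is the lift of `X`. -/
def ambientKKS (ξ : Orbit d N) : Matrix (Fin N) (Fin N) ℂ [⋀^Fin 2]→L[ℝ] ℝ where
  toFun m := alphaPairing ξ.incl ⁅ξ.lift (m 0), ξ.lift (m 1)⁆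
  map_update_add' m i x y := by
    fin_cases i <;> simp [lift_add, ← alphaPairing_add, Ring.lie_def, Matrix.add_mul, Matrix.mul_add] <;>
      congr 1 <;> abel
  map_update_smul' m i c x := by
    fin_cases i <;>
      simp [lift_smul, smul_lie_matrix, lie_smul_matrix, alphaPairing_smul]
  cont := by
    have h0 : Continuous fun m : Fin 2 → Matrix (Fin N) (Fin N) ℂ => ξ.lift (m 0) :=
      ξ.continuous_lift.comp (continuous_apply 0)
    have h1 : Continuous fun m : Fin 2 → Matrix (Fin N) (Fin N) ℂ => ξ.lift (m 1) :=
      ξ.continuous_lift.comp (continuous_apply 1)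
    have hb : Continuous fun m : Fin 2 → Matrix (Fin N) (Fin N) ℂ =>
        ⁅ξ.lift (m 0), ξ.lift (m 1)⁆ := (h0.matrix_mul h1).sub (h1.matrix_mul h0)
    exact Complex.continuous_re.comp (continuous_const.mul
      (hb.matrix_conjTranspose.matrix_mul continuous_const).matrix_trace)
  map_eq_zero_of_eq' m i j h hij := by
    have h01 : m 0 = m 1 := by
      fin_cases i <;> fin_cases j <;> simp_all
    change alphaPairing ξ.incl ⁅ξ.lift (m 0), ξ.lift (m 1)⁆ = 0
    rw [h01, Ring.lie_def, sub_self]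
    simp [alphaPairing]

variable [Fact (0 < d)] [Fact (d ≤ N)]

/-- The differential of the inclusion, from the tangent space of the orbit into matrices. -/
def tangentIncl (ξ : Orbit d N) :
    TangentSpace 𝓘(ℝ, OrbitModel d N) ξ →L[ℝ] Matrix (Fin N) (Fin N) ℂ :=
  mfderiv 𝓘(ℝ, OrbitModel d N) 𝓘(ℝ, Matrix (Fin N) (Fin N) ℂ) incl ξ

/-- The Kirillov–Kostant–Souriau form: `ω_ξ(⁅η, ξ⁆, ⁅η', ξ⁆) = α_ξ(⁅η, η'⁆)`. -/
def kksForm (d N : ℕ) [Fact (0 < d)] [Fact (d ≤ N)] : TwoForm (OrbitModel d N) (Orbit d N) :=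
  fun ξ => ξ.ambientKKS.compContinuousLinearMap ξ.tangentIncl

end Orbit

/-! ### The torus action -/

namespace Orbit

variable {d N : ℕ} [hd : Fact (0 < d)] [hN : Fact (d ≤ N)]

/-- The action of `U(N)` on `𝒪_{N/d}` by conjugation. -/
instance : MulAction (Matrix.unitaryGroup (Fin N) ℂ) (Orbit d N) where
  smul U ξ := ⟨(U : Matrix (Fin N) (Fin N) ℂ) * ξ.incl * (U : Matrix (Fin N) (Fin N) ℂ)ᴴ, by
    have hU : (U : Matrix (Fin N) (Fin N) ℂ)ᴴ * U = 1 := Unitary.coe_star_mul_self U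
    obtain ⟨h, h2, ht⟩ := (isOrbitMatrix_iff hd.out hN.out _).1 ξ.2
    refine (isOrbitMatrix_iff hd.out hN.out _).2 ⟨?_, ?_, ?_⟩
    · have : (ξ.incl)ᴴ = ξ.incl := h
      simp [Matrix.IsHermitian, Matrix.conjTranspose_mul, this, Matrix.mul_assoc]
    · have h2' : ξ.incl * ξ.incl = ((N : ℂ) / d) • ξ.incl := h2
      generalize (U : Matrix (Fin N) (Fin N) ℂ) = V at *
      calc V * ξ.incl * Vᴴ * (V * ξ.incl * Vᴴ) = V * ξ.incl * (Vᴴ * V) * ξ.incl * Vᴴ := by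
            simp only [Matrix.mul_assoc]
        _ = V * (ξ.incl * ξ.incl) * Vᴴ := by rw [hU]; simp only [Matrix.mul_assoc, Matrix.one_mul]
        _ = _ := by rw [h2']; simp only [Matrix.mul_smul, Matrix.smul_mul]
    · rw [Matrix.trace_mul_comm, ← Matrix.mul_assoc, hU, Matrix.one_mul]
      exact ht⟩
  one_smul ξ := Subtype.ext (by
    change _ * ξ.incl * _ = ξ.incl
    simp)
  mul_smul U V ξ := Subtype.ext (by
    change _ * ξ.incl * _ = _ * (_ * ξ.incl * _) * _
    simp [Matrix.conjTranspose_mul, Matrix.mul_assoc])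

end Orbit

/-- The torus `U(1)^N` as the group of diagonal unitary matrices. -/
def torusToUnitary (N : ℕ) : (Fin N → Circle) →* Matrix.unitaryGroup (Fin N) ℂ where
  toFun g := ⟨Matrix.diagonal fun k => (g k : ℂ), by
    rw [Matrix.mem_unitaryGroup_iff, Matrix.star_eq_conjTranspose, Matrix.diagonal_conjTranspose,
      Matrix.diagonal_mul_diagonal, ← Matrix.diagonal_one]
    congr 1
    ext k
    simp [Complex.mul_conj, Circle.normSq_coe]⟩
  map_one' := Subtype.ext (by simp)
  map_mul' g h := Subtype.ext (by simp)

/-- The scalars `U(1)` inside `U(1)^N`. -/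
def scalarTorus (N : ℕ) : Subgroup (Fin N → Circle) :=
  (Pi.constMonoidHom (Fin N) Circle).range

/-- With `N = n + 1`, the torus `G = U(1)^N / U(1)`, identified with the elements of `U(1)^N` whose
last entry is `1`, that is, with `U(1)^n`. -/
abbrev EffTorus (n : ℕ) : Type := Fin n → Circle

/-- The inclusion of `G` into `U(1)^N`, which appends the entry `1`. -/
def EffTorus.incl (n : ℕ) : EffTorus n →* (Fin (n + 1) → Circle) where
  toFun g := Fin.snoc (α := fun _ => Circle) g 1
  map_one' := by
    ext k
    refine Fin.lastCases ?_ (fun i => ?_) k <;> simp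
  map_mul' g h := by
    ext k
    refine Fin.lastCases ?_ (fun i => ?_) k <;> simp

/-- `G` acts on `𝒪_{N/d}` by conjugation: `D • ξ = D ξ Dᴴ`. -/
instance {d n : ℕ} [Fact (0 < d)] [Fact (d ≤ n + 1)] : MulAction (EffTorus n) (Orbit d (n + 1)) :=
  MulAction.compHom _ ((torusToUnitary (n + 1)).comp (EffTorus.incl n))

/-- The coordinate `θ_k` on the Lie algebra of `G`: a tangent vector `v` at `1` changes the `k`-th
entry of `g` with velocity `i θ_k(v)`; so `v` is the matrix `diag(i θ_1, …, i θ_n, 0)`. -/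
def EffTorus.angle {n : ℕ} (k : Fin n) :
    GroupLieAlgebra (torusModel (Fin n)) (EffTorus n) →L[ℝ] ℝ :=
  Complex.imCLM.comp
    (mfderiv (torusModel (Fin n)) 𝓘(ℝ, ℂ) (fun g : EffTorus n => (g k : ℂ)) 1)

/-- The identification `ℝ^n ≈ 𝔤*`, under which `x` is the functional `v ↦ ½ ∑ x_k θ_k(v)`. -/
def EffTorus.dualOfCoords (n : ℕ) (x : Fin n → ℝ) :
    GroupLieAlgebra (torusModel (Fin n)) (EffTorus n) →L[ℝ] ℝ :=
  (1 / 2 : ℝ) • ∑ k, x k • EffTorus.angle k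

/-- The map `Φ_G`: the first `n = N - 1` diagonal entries of a matrix in the orbit. -/
def Orbit.momentum {d n : ℕ} (ξ : Orbit d (n + 1)) (k : Fin n) : ℝ :=
  (ξ.incl k.castSucc k.castSucc).re

/-! ### Tight frames -/

/-- The space of `N / d`-tight frames of `N` vectors in `ℂ^d` (the columns of a matrix). -/
def TightFrame (d N : ℕ) : Type :=
  {F : Matrix (Fin d) (Fin N) ℂ // F * Fᴴ = ((N : ℂ) / d) • (1 : Matrix (Fin d) (Fin d) ℂ)}

namespace TightFrame

variable {d N : ℕ}

/-- The matrix of a frame. -/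
def mat (F : TightFrame d N) : Matrix (Fin d) (Fin N) ℂ := F.1

instance : TopologicalSpace (TightFrame d N) := instTopologicalSpaceSubtype

theorem mat_mul (F : TightFrame d N) :
    F.mat * F.matᴴ = ((N : ℂ) / d) • (1 : Matrix (Fin d) (Fin d) ℂ) := F.2

/-- The action of `U(d)` by left multiplication. -/
instance : MulAction (Matrix.unitaryGroup (Fin d) ℂ) (TightFrame d N) where
  smul A F := ⟨(A : Matrix (Fin d) (Fin d) ℂ) * F.mat, by
    have hA : (A : Matrix (Fin d) (Fin d) ℂ) * (A : Matrix (Fin d) (Fin d) ℂ)ᴴ = 1 :=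
      Unitary.coe_mul_star_self A
    rw [Matrix.conjTranspose_mul, Matrix.mul_assoc, ← Matrix.mul_assoc F.mat, F.mat_mul,
      Matrix.smul_mul, Matrix.one_mul, Matrix.mul_smul, hA]⟩
  one_smul F := Subtype.ext (by
    change _ * F.mat = F.mat
    simp)
  mul_smul A B F := Subtype.ext (by
    change _ * F.mat = _ * (_ * F.mat)
    simp [Matrix.mul_assoc])

/-- The action of `U(1)^N` by `D · F = F Dᴴ`. -/
def torusAct (g : Fin N → Circle) (F : TightFrame d N) : TightFrame d N :=
  ⟨F.mat * (torusToUnitary N g : Matrix (Fin N) (Fin N) ℂ)ᴴ, by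
    have hD : (torusToUnitary N g : Matrix (Fin N) (Fin N) ℂ)ᴴ * torusToUnitary N g = 1 :=
      Unitary.coe_star_mul_self _
    rw [Matrix.conjTranspose_mul, Matrix.conjTranspose_conjTranspose, Matrix.mul_assoc,
      ← Matrix.mul_assoc _ _ F.matᴴ, hD, Matrix.one_mul, F.mat_mul]⟩

/-- `X` is tangent at `F` to the level set `{F | F Fᴴ = N / d}`. -/
def IsTangent (F : TightFrame d N) (X : Matrix (Fin d) (Fin N) ℂ) : Prop :=
  X * F.matᴴ + F.mat * Xᴴ = 0

/-- The Gram matrix `Fᴴ F`, an element of `𝒪_{N/d}`. -/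
def gram [hd : Fact (0 < d)] [hN : Fact (d ≤ N)] (F : TightFrame d N) : Orbit d N :=
  ⟨F.matᴴ * F.mat, by
    have hd' : (d : ℂ) ≠ 0 := by exact_mod_cast hd.out.ne'
    refine (isOrbitMatrix_iff hd.out hN.out _).2 ⟨?_, ?_, ?_⟩
    · simp [Matrix.IsHermitian]
    · rw [Matrix.mul_assoc, ← Matrix.mul_assoc F.mat, F.mat_mul]
      simp
    · rw [Matrix.trace_mul_comm, F.mat_mul, Matrix.trace_smul, Matrix.trace_one]
      simp
      field_simp⟩

variable (d N) in
/-- The space of unitary equivalence classes of `N / d`-tight frames. -/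
abbrev Classes : Type := MulAction.orbitRel.Quotient (Matrix.unitaryGroup (Fin d) ℂ) (TightFrame d N)

/-- The map `[F] ↦ Fᴴ F`. -/
def gramClass [Fact (0 < d)] [Fact (d ≤ N)] : Classes d N → Orbit d N :=
  Quotient.lift gram (by
    rintro _ F ⟨A, rfl⟩
    have hA : (A : Matrix (Fin d) (Fin d) ℂ)ᴴ * A = 1 := Unitary.coe_star_mul_self A
    refine Subtype.ext ?_
    change ((A : Matrix (Fin d) (Fin d) ℂ) * F.mat)ᴴ *
      ((A : Matrix (Fin d) (Fin d) ℂ) * F.mat) = F.matᴴ * F.mat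
    rw [Matrix.conjTranspose_mul, Matrix.mul_assoc, ← Matrix.mul_assoc _ _ F.mat, hA,
      Matrix.one_mul])

end TightFrame

/-- `𝒪_{N/d}` is a smooth manifold, embedded in the space of matrices, with tangent space
`{⁅η, ξ⁆ | η ∈ 𝔲(N)}` at `ξ`, a single orbit of `U(N)`, and its form is characterized by the
Kirillov–Kostant–Souriau formula. -/
structure IsCoadjointOrbit (d N : ℕ) [Fact (0 < d)] [Fact (d ≤ N)] : Prop where
  isManifold : IsManifold 𝓘(ℝ, OrbitModel d N) ∞ (Orbit d N)
  smooth_incl : ContMDiff 𝓘(ℝ, OrbitModel d N) 𝓘(ℝ, Matrix (Fin N) (Fin N) ℂ) ∞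
    (Orbit.incl : Orbit d N → Matrix (Fin N) (Fin N) ℂ)
  injective : ∀ ξ : Orbit d N, Function.Injective ξ.tangentIncl
  range_eq : ∀ ξ : Orbit d N, Set.range ξ.tangentIncl =
    {X | ∃ η : Matrix (Fin N) (Fin N) ℂ, ηᴴ = -η ∧ X = ⁅η, ξ.incl⁆}
  nonempty : Nonempty (Orbit d N)
  transitive : MulAction.IsPretransitive (Matrix.unitaryGroup (Fin N) ℂ) (Orbit d N)
  kks : ∀ (ξ : Orbit d N) (v w : TangentSpace 𝓘(ℝ, OrbitModel d N) ξ)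
    (η η' : Matrix (Fin N) (Fin N) ℂ), ηᴴ = -η → η'ᴴ = -η' →
    ξ.tangentIncl v = ⁅η, ξ.incl⁆ → ξ.tangentIncl w = ⁅η', ξ.incl⁆ →
    Orbit.kksForm d N ξ ![v, w] = alphaPairing ξ.incl ⁅η, η'⁆

/-- `[F] ↦ Fᴴ F` identifies the symplectic quotient of `N / d`-tight frames by `U(d)` with
`𝒪_{N/d}`, compatibly with the actions of `U(1)^N`. -/
structure GramIsSymplectomorphism (d N : ℕ) [Fact (0 < d)] [Fact (d ≤ N)] : Prop where
  isHomeomorph : IsHomeomorph (TightFrame.gramClass (d := d) (N := N))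
  equivariant : ∀ (g : Fin N → Circle) (F : TightFrame d N),
    (F.torusAct g).gram = torusToUnitary N g • F.gram
  /-- the differential of `F ↦ Fᴴ F` is onto the tangent space of the orbit -/
  range_eq : ∀ F : TightFrame d N, Set.range F.gram.tangentIncl =
    {T | ∃ X, F.IsTangent X ∧ T = Xᴴ * F.mat + F.matᴴ * X}
  /-- and its kernel is the tangent space of the `U(d)`-orbit of `F` -/
  ker_eq : ∀ (F : TightFrame d N) (X : Matrix (Fin d) (Fin N) ℂ), F.IsTangent X →
    (Xᴴ * F.mat + F.matᴴ * X = 0 ↔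
      ∃ η : Matrix (Fin d) (Fin d) ℂ, ηᴴ = -η ∧ X = η * F.mat)
  /-- the form on the orbit pulls back to the restriction of the standard symplectic form
  `(X, Y) ↦ -Im tr (Yᴴ X)` to tight frames -/
  pullback : ∀ (F : TightFrame d N) (X Y : Matrix (Fin d) (Fin N) ℂ),
    F.IsTangent X → F.IsTangent Y → ∀ v w : TangentSpace 𝓘(ℝ, OrbitModel d N) F.gram,
    F.gram.tangentIncl v = Xᴴ * F.mat + F.matᴴ * X →
    F.gram.tangentIncl w = Yᴴ * F.mat + F.matᴴ * Y →
    Orbit.kksForm d N F.gram ![v, w] = -((Yᴴ * X).trace).im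

end

/-!
Near a point of the orbit, a Hermitian matrix of the same spectral type is determined by its image,
the graph of a map `Z` from the image of the point to its kernel; these slopes are the charts. The
velocity of the graph projection in the direction `U` is its bracket with `S(U) - S(U)ᴴ`, where
`S(U)` is the component of the velocity from the graph to its complement. This matrix is
skew-Hermitian, so tangent vectors are brackets and the Kirillov–Kostant–Souriau form becomes
`-(N/d) Im tr(S(U)ᴴ S(V))`. In each chart this is the exterior derivative of
`V ↦ -(N/2d) Im tr((1 + ZᴴZ)⁻¹ ZᴴV)`, hence closed, and at the centre of the chart it is
`-(N/d) Im tr(UᴴV)`, hence nondegenerate.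

For a tight frame `F`, a tangent vector `X` is carried to the bracket of `FᴴF` with the
skew-Hermitian matrix `(d/N)(XᴴF - FᴴX)`, from which the pullback of the form is read off.

Hamilton's equation holds because the momentum map is linear in the matrix `ξ`: pairing its
diagonal with `v` is `Re tr(-(i/2) v ξ)`, and `ω([v, ξ], ·)` is the same trace pairing with `v`. The
action is effective when `d < N`: some point of the orbit has a nonzero `(k, N)` entry, since some
tangent vector at a diagonal matrix does, and a diagonal unitary matrix with last entry `1`
multiplies that entry by its own `k`th entry.
-/

noncomputable section

/-- The conjugate transpose as a continuous `ℝ`-linear map; over `ℂ` it is only semilinear. -/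
def conjTransposeCLM (l m : Type*) : Matrix l m ℂ →L[ℝ] Matrix m l ℂ where
  toFun A := Aᴴ
  map_add' := Matrix.conjTranspose_add
  map_smul' c A := by rw [Matrix.conjTranspose_smul, star_trivial, RingHom.id_apply]
  cont := continuous_id.matrix_conjTranspose

section MatrixCalculus

variable {l m k : Type*} [Fintype l] [Fintype m] [Fintype k] [DecidableEq m]

theorem isBoundedBilinearMap_matrix_mul [DecidableEq k] :
    IsBoundedBilinearMap ℝ (fun p : Matrix l m ℂ × Matrix m k ℂ => p.1 * p.2) where
  add_left _ _ _ := Matrix.add_mul _ _ _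
  smul_left _ _ _ := Matrix.smul_mul _ _ _
  add_right _ _ _ := Matrix.mul_add _ _ _
  smul_right _ _ _ := Matrix.mul_smul _ _ _
  bound := ⟨1, one_pos, fun A B => by simpa using Matrix.l2_opNorm_mul A B⟩

section ContDiffOn

variable {E : Type*} [NormedAddCommGroup E] [NormedSpace ℝ E] {s : Set E} {n : WithTop ℕ∞}

theorem contDiffOn_matrix_mul [DecidableEq k] {f : E → Matrix l m ℂ} {g : E → Matrix m k ℂ}
    (hf : ContDiffOn ℝ n f s) (hg : ContDiffOn ℝ n g s) :
    ContDiffOn ℝ n (fun x => f x * g x) s :=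
  isBoundedBilinearMap_matrix_mul.contDiff.comp_contDiffOn (hf.prodMk hg)

theorem contDiffOn_matrix_conjTranspose [DecidableEq l] {f : E → Matrix l m ℂ}
    (hf : ContDiffOn ℝ n f s) : ContDiffOn ℝ n (fun x => (f x)ᴴ) s :=
  (conjTransposeCLM l m).contDiff.comp_contDiffOn hf

theorem contDiffOn_matrix_inv {f : E → Matrix m m ℂ} (hf : ContDiffOn ℝ n f s)
    (hu : ∀ x ∈ s, IsUnit (f x).det) : ContDiffOn ℝ n (fun x => (f x)⁻¹) s := by
  intro x hx
  obtain ⟨u, hu⟩ := (Matrix.isUnit_iff_isUnit_det _).2 (hu x hx)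
  have hinv := contDiffAt_ringInverse ℝ (n := n) u
  rw [hu] at hinv
  simp only [Matrix.nonsing_inv_eq_ringInverse]
  exact hinv.comp_contDiffWithinAt x (hf x hx)

end ContDiffOn

end MatrixCalculus

section MatrixHasDerivAt

variable {l m k : Type*} {t : ℝ}

theorem hasDerivAt_matrix_mul [Finite l] [Fintype m] [Finite k] {f : ℝ → Matrix l m ℂ}
    {g : ℝ → Matrix m k ℂ} {f' : Matrix l m ℂ} {g' : Matrix m k ℂ} (hf : HasDerivAt f f' t)
    (hg : HasDerivAt g g' t) : HasDerivAt (fun x => f x * g x) (f' * g t + f t * g') t := by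
  classical
  have := Fintype.ofFinite l
  have := Fintype.ofFinite k
  have h := (isBoundedBilinearMap_matrix_mul.hasFDerivAt (f t, g t)).comp_hasDerivAt t
    (hf.prodMk hg)
  exact h.congr_deriv (add_comm _ _)

theorem hasDerivAt_matrix_conjTranspose [Finite l] [Finite m] {f : ℝ → Matrix l m ℂ}
    {f' : Matrix l m ℂ} (hf : HasDerivAt f f' t) : HasDerivAt (fun x => (f x)ᴴ) f'ᴴ t := by
  classical
  have := Fintype.ofFinite l
  have := Fintype.ofFinite m
  exact (conjTransposeCLM l m).hasFDerivAt.comp_hasDerivAt t hf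

theorem hasDerivAt_matrix_inv [Fintype m] [DecidableEq m] {f : ℝ → Matrix m m ℂ}
    {f' : Matrix m m ℂ} (hf : HasDerivAt f f' t) (hu : IsUnit (f t).det) :
    HasDerivAt (fun x => (f x)⁻¹) (-((f t)⁻¹ * f' * (f t)⁻¹)) t := by
  obtain ⟨u, hu⟩ := (Matrix.isUnit_iff_isUnit_det _).2 hu
  have h := hasFDerivAt_ringInverse (𝕜 := ℝ) u
  rw [hu] at h
  simp only [Matrix.nonsing_inv_eq_ringInverse]
  refine (h.comp_hasDerivAt t hf).congr_deriv ?_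
  rw [← hu, Ring.inverse_unit]
  rfl

end MatrixHasDerivAt

section LineDeriv

variable {E F : Type*} [NormedAddCommGroup E] [NormedSpace ℝ E]
  [NormedAddCommGroup F] [NormedSpace ℝ F]

theorem hasLineDerivAt_id (x v : E) : HasLineDerivAt ℝ (fun y => y) v x v :=
  (hasFDerivAt_id x).hasLineDerivAt v

theorem fderiv_apply_eq_of_hasLineDerivAt {f : E → F} {x v : E} {f' : F}
    (hf : DifferentiableAt ℝ f x) (h : HasLineDerivAt ℝ f f' x v) : fderiv ℝ f x v = f' :=
  hf.lineDeriv_eq_fderiv.symm.trans h.lineDeriv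

end LineDeriv

/-! ### The graph charts -/

namespace Splitting

variable {d N : ℕ}

section

variable (s : Splitting d N) (Z U V : Matrix (Fin (N - d)) (Fin d) ℂ)

/-- The orthogonal projection onto the graph of `Z`, so that `graphMatrix` is `N / d` times it. -/
def graphProj : Matrix (Fin N) (Fin N) ℂ :=
  s.graphFrame Z * (1 + Zᴴ * Z)⁻¹ * (s.graphFrame Z)ᴴ

theorem graphMatrix_eq_smul_graphProj : s.graphMatrix Z = ((N : ℂ) / d) • s.graphProj Z := rfl

theorem isHermitian_inv_gram : ((1 + Zᴴ * Z)⁻¹).IsHermitian :=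
  (Matrix.isHermitian_one.add (Matrix.isHermitian_conjTranspose_mul_self Z)).inv

theorem isHermitian_graphProj : (s.graphProj Z).IsHermitian :=
  Matrix.isHermitian_mul_mul_conjTranspose _ (isHermitian_inv_gram Z)

theorem conjTranspose_graphFrame_mul_graphProj :
    (s.graphFrame Z)ᴴ * s.graphProj Z = (s.graphFrame Z)ᴴ := by
  rw [graphProj, ← Matrix.mul_assoc, ← Matrix.mul_assoc, graphFrame_gram,
    Matrix.mul_nonsing_inv _ (isUnit_gram Z), Matrix.one_mul]

theorem graphProj_mul_self : s.graphProj Z * s.graphProj Z = s.graphProj Z := by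
  nth_rw 1 [graphProj]
  rw [Matrix.mul_assoc, conjTranspose_graphFrame_mul_graphProj, graphProj]

theorem conjTranspose_graphFrame_mul_B : (s.graphFrame Z)ᴴ * s.B = Zᴴ := by
  simpa only [Matrix.conjTranspose_mul, Matrix.conjTranspose_conjTranspose] using
    congrArg Matrix.conjTranspose (s.B_graphFrame Z)

theorem conjTranspose_B_mul_one_sub_graphProj_mul_B :
    s.Bᴴ * (1 - s.graphProj Z) * s.B = 1 - Z * (1 + Zᴴ * Z)⁻¹ * Zᴴ := by
  have hBPB : s.Bᴴ * s.graphProj Z * s.B = Z * (1 + Zᴴ * Z)⁻¹ * Zᴴ := by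
    rw [graphProj, ← Matrix.mul_assoc, ← Matrix.mul_assoc, B_graphFrame, Matrix.mul_assoc,
      conjTranspose_graphFrame_mul_B]
  rw [Matrix.mul_sub, Matrix.sub_mul, Matrix.mul_one, hBB, hBPB]

/-- The component of the velocity of the graph projection that maps the graph of `Z` to its
orthogonal complement, when `Z` moves with velocity `U`. -/
def slope : Matrix (Fin N) (Fin N) ℂ :=
  (1 - s.graphProj Z) * (s.B * U) * (1 + Zᴴ * Z)⁻¹ * (s.graphFrame Z)ᴴ

theorem slope_mul_graphProj : s.slope Z U * s.graphProj Z = s.slope Z U := by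
  rw [slope, Matrix.mul_assoc, conjTranspose_graphFrame_mul_graphProj]

theorem graphProj_mul_slope : s.graphProj Z * s.slope Z U = 0 := by
  have hPR : s.graphProj Z * (1 - s.graphProj Z) = 0 := by
    rw [Matrix.mul_sub, Matrix.mul_one, graphProj_mul_self, sub_self]
  simp only [slope, ← Matrix.mul_assoc, hPR, Matrix.zero_mul]

theorem graphProj_mul_conjTranspose_slope :
    s.graphProj Z * (s.slope Z U)ᴴ = (s.slope Z U)ᴴ := by
  simpa only [Matrix.conjTranspose_mul, (s.isHermitian_graphProj Z).eq] using
    congrArg Matrix.conjTranspose (s.slope_mul_graphProj Z U)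

theorem conjTranspose_slope_mul_graphProj : (s.slope Z U)ᴴ * s.graphProj Z = 0 := by
  simpa only [Matrix.conjTranspose_mul, (s.isHermitian_graphProj Z).eq,
    Matrix.conjTranspose_zero] using congrArg Matrix.conjTranspose (s.graphProj_mul_slope Z U)

theorem slope_mul_slope : s.slope Z U * s.slope Z V = 0 := by
  rw [← slope_mul_graphProj, Matrix.mul_assoc, graphProj_mul_slope, Matrix.mul_zero]

theorem trace_conjTranspose_slope_mul_slope :
    ((s.slope Z U)ᴴ * s.slope Z V).trace =
      ((1 + Zᴴ * Z)⁻¹ * Uᴴ * (1 - Z * (1 + Zᴴ * Z)⁻¹ * Zᴴ) * V).trace := by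
  have hR : (1 - s.graphProj Z)ᴴ * (1 - s.graphProj Z) = 1 - s.graphProj Z := by
    rw [(Matrix.isHermitian_one.sub (s.isHermitian_graphProj Z)).eq, Matrix.sub_mul,
      Matrix.mul_sub (s.graphProj Z), graphProj_mul_self, Matrix.mul_one, sub_self, sub_zero,
      Matrix.one_mul]
  rw [← conjTranspose_B_mul_one_sub_graphProj_mul_B s Z, ← hR]
  simp only [slope]
  generalize 1 - s.graphProj Z = R
  calc ((R * (s.B * U) * (1 + Zᴴ * Z)⁻¹ * (s.graphFrame Z)ᴴ)ᴴ *
          (R * (s.B * V) * (1 + Zᴴ * Z)⁻¹ * (s.graphFrame Z)ᴴ)).trace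
      = (s.graphFrame Z * ((1 + Zᴴ * Z)⁻¹ * Uᴴ * (s.Bᴴ * (Rᴴ * R) * s.B) * V *
          (1 + Zᴴ * Z)⁻¹ * (s.graphFrame Z)ᴴ)).trace := by
        simp only [Matrix.conjTranspose_mul, Matrix.conjTranspose_conjTranspose,
          (isHermitian_inv_gram Z).eq, Matrix.mul_assoc]
    _ = ((1 + Zᴴ * Z)⁻¹ * Uᴴ * (s.Bᴴ * (Rᴴ * R) * s.B) * V).trace := by
        rw [Matrix.trace_mul_comm, Matrix.mul_assoc, graphFrame_gram,
          Matrix.nonsing_inv_mul_cancel_right _ _ (isUnit_gram Z)]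

end

section Smoothness

variable {n : WithTop ℕ∞}

theorem contDiff_graphFrame (s : Splitting d N) : ContDiff ℝ n s.graphFrame := by
  rw [← contDiffOn_univ]
  exact contDiffOn_const.add (contDiffOn_matrix_mul contDiffOn_const contDiffOn_id)

theorem contDiff_inv_gram :
    ContDiff ℝ n (fun Z : Matrix (Fin (N - d)) (Fin d) ℂ => (1 + Zᴴ * Z)⁻¹) := by
  rw [← contDiffOn_univ]
  exact contDiffOn_matrix_inv (contDiffOn_const.add (contDiffOn_matrix_mul
    (contDiffOn_matrix_conjTranspose contDiffOn_id) contDiffOn_id)) fun Z _ => isUnit_gram Z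

theorem contDiff_graphProj (s : Splitting d N) : ContDiff ℝ n s.graphProj := by
  have hW := s.contDiff_graphFrame.contDiffOn (n := n) (s := Set.univ)
  rw [← contDiffOn_univ]
  exact contDiffOn_matrix_mul (contDiffOn_matrix_mul hW contDiff_inv_gram.contDiffOn)
    (contDiffOn_matrix_conjTranspose hW)

theorem contDiff_graphMatrix (s : Splitting d N) : ContDiff ℝ n s.graphMatrix :=
  s.contDiff_graphProj.const_smul ((N : ℂ) / d)

theorem isOpen_coord_domain (s : Splitting d N) :
    IsOpen {ξ : Matrix (Fin N) (Fin N) ℂ | (s.Aᴴ * ξ * s.A).det ≠ 0} :=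
  isOpen_ne_fun ((continuous_const.matrix_mul continuous_id).matrix_mul
    continuous_const).matrix_det continuous_const

theorem contDiffOn_coord (s : Splitting d N) :
    ContDiffOn ℝ n s.coord {ξ : Matrix (Fin N) (Fin N) ℂ | (s.Aᴴ * ξ * s.A).det ≠ 0} := by
  have hC : ∀ {m : ℕ} (C : Matrix (Fin m) (Fin N) ℂ),
      ContDiffOn ℝ n (fun ξ : Matrix (Fin N) (Fin N) ℂ => C * ξ * s.A)
        {ξ | (s.Aᴴ * ξ * s.A).det ≠ 0} := fun _ =>
    contDiffOn_matrix_mul (contDiffOn_matrix_mul contDiffOn_const contDiffOn_id) contDiffOn_const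
  exact contDiffOn_matrix_mul (hC s.Bᴴ) (contDiffOn_matrix_inv (hC s.Aᴴ) fun _ hξ => .mk0 _ hξ)

end Smoothness

section Velocity

variable (s : Splitting d N) (Z U : Matrix (Fin (N - d)) (Fin d) ℂ)

theorem fderiv_graphProj : fderiv ℝ s.graphProj Z U = s.slope Z U + (s.slope Z U)ᴴ := by
  refine fderiv_apply_eq_of_hasLineDerivAt
    ((s.contDiff_graphProj (n := 1)).differentiable one_ne_zero _) ?_
  have hZ := hasLineDerivAt_id Z U
  have hW : HasDerivAt (fun t : ℝ => s.graphFrame (Z + t • U)) (s.B * U) 0 := by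
    refine ((hasDerivAt_matrix_mul (hasDerivAt_const 0 s.B) hZ).const_add s.A).congr_deriv ?_
    rw [Matrix.zero_mul, zero_add]
  have hgram : HasDerivAt (fun t : ℝ => 1 + (Z + t • U)ᴴ * (Z + t • U))
      ((s.B * U)ᴴ * s.graphFrame Z + (s.graphFrame Z)ᴴ * (s.B * U)) 0 := by
    simpa only [graphFrame_gram, zero_smul, add_zero] using
      hasDerivAt_matrix_mul (hasDerivAt_matrix_conjTranspose hW) hW
  have hP := hasDerivAt_matrix_mul (hasDerivAt_matrix_mul hW (hasDerivAt_matrix_inv hgram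
    (isUnit_gram _))) (hasDerivAt_matrix_conjTranspose hW)
  refine hP.congr_deriv ?_
  simp only [zero_smul, add_zero, slope, graphProj, Matrix.conjTranspose_mul,
    Matrix.conjTranspose_sub, Matrix.conjTranspose_conjTranspose, (isHermitian_inv_gram Z).eq,
    Matrix.sub_mul, Matrix.add_mul, Matrix.mul_add, Matrix.one_mul, Matrix.mul_neg, Matrix.neg_mul,
    Matrix.mul_assoc]
  abel

theorem fderiv_graphMatrix :
    fderiv ℝ s.graphMatrix Z U = ((N : ℂ) / d) • (s.slope Z U + (s.slope Z U)ᴴ) := by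
  have hP := (s.contDiff_graphProj (n := 1)).differentiable one_ne_zero Z
  rw [← fderiv_graphProj, show s.graphMatrix = ((N : ℂ) / d) • s.graphProj from rfl,
    fderiv_const_smul hP]
  rfl

theorem fderiv_graphMatrix_eq_lie :
    fderiv ℝ s.graphMatrix Z U = ⁅s.slope Z U - (s.slope Z U)ᴴ, s.graphMatrix Z⁆ := by
  rw [fderiv_graphMatrix, graphMatrix_eq_smul_graphProj, Ring.lie_def, Matrix.mul_smul,
    Matrix.smul_mul, ← smul_sub, Matrix.sub_mul, Matrix.mul_sub, slope_mul_graphProj,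
    graphProj_mul_slope, graphProj_mul_conjTranspose_slope, conjTranspose_slope_mul_graphProj,
    sub_zero, zero_sub, sub_neg_eq_add]

end Velocity

end Splitting

/-! ### Brackets of Hermitian and skew-Hermitian matrices -/

section Bracket

theorem conjTranspose_lie {m R : Type*} [Fintype m] [Ring R] [StarRing R] (A B : Matrix m m R) :
    ⁅A, B⁆ᴴ = ⁅Bᴴ, Aᴴ⁆ := by
  simp only [Ring.lie_def, Matrix.conjTranspose_sub, Matrix.conjTranspose_mul]

theorem isHermitian_lie {m R : Type*} [Fintype m] [Ring R] [StarRing R] {η ξ : Matrix m m R}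
    (hη : ηᴴ = -η) (hξ : ξ.IsHermitian) : ⁅η, ξ⁆.IsHermitian := by
  rw [Matrix.IsHermitian, conjTranspose_lie, hη, hξ.eq]
  simp only [Ring.lie_def, Matrix.mul_neg, Matrix.neg_mul]
  abel

theorem conjTranspose_sub_conjTranspose {m R : Type*} [AddGroup R] [StarAddMonoid R]
    (A : Matrix m m R) : (A - Aᴴ)ᴴ = -(A - Aᴴ) := by
  rw [Matrix.conjTranspose_sub, Matrix.conjTranspose_conjTranspose, neg_sub]

theorem lie_lie_lie_of_mul_self_eq_smul {R A : Type*} [CommRing R] [Ring A] [Algebra R A] {c : R}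
    {ξ : A} (hξ : ξ * ξ = c • ξ) (η : A) : ⁅⁅⁅η, ξ⁆, ξ⁆, ξ⁆ = c ^ 2 • ⁅η, ξ⁆ := by
  have hξξ (X : A) : ξ * (ξ * X) = c • (ξ * X) := by rw [← mul_assoc, hξ, smul_mul_assoc]
  simp only [Ring.lie_def, sub_mul, mul_sub, mul_assoc, hξ, hξξ, mul_smul_comm, smul_mul_assoc,
    smul_sub, smul_smul, ← sq]
  abel

end Bracket

namespace Splitting

variable {d N : ℕ} (s t : Splitting d N)

theorem graphFrame_zero : s.graphFrame 0 = s.A := by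
  rw [graphFrame, Matrix.mul_zero, add_zero]

theorem graphProj_zero : s.graphProj 0 = s.A * s.Aᴴ := by
  rw [graphProj, graphFrame_zero, Matrix.mul_zero, add_zero, inv_one, Matrix.mul_one]

theorem one_sub_A_mul_conjTranspose_A : 1 - s.A * s.Aᴴ = s.B * s.Bᴴ := by
  rw [← s.hsum, add_sub_cancel_left]

theorem slope_zero (U : Matrix (Fin (N - d)) (Fin d) ℂ) : s.slope 0 U = s.B * U * s.Aᴴ := by
  rw [slope, graphProj_zero, one_sub_A_mul_conjTranspose_A, graphFrame_zero, Matrix.mul_zero,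
    add_zero, inv_one, Matrix.mul_one, Matrix.mul_assoc s.B, ← Matrix.mul_assoc s.Bᴴ, s.hBB,
    Matrix.one_mul]

theorem lie_A_mul_conjTranspose_A {η : Matrix (Fin N) (Fin N) ℂ} (hη : ηᴴ = -η) :
    ⁅η, s.A * s.Aᴴ⁆ = s.B * (s.Bᴴ * η * s.A) * s.Aᴴ + s.A * (s.Bᴴ * η * s.A)ᴴ * s.Bᴴ := by
  calc ⁅η, s.A * s.Aᴴ⁆ = (1 - s.A * s.Aᴴ) * η * (s.A * s.Aᴴ) -
          s.A * s.Aᴴ * η * (1 - s.A * s.Aᴴ) := by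
        simp only [Ring.lie_def, Matrix.sub_mul, Matrix.mul_sub, Matrix.one_mul, Matrix.mul_one]
        abel
    _ = s.B * (s.Bᴴ * η * s.A) * s.Aᴴ + s.A * (s.Bᴴ * η * s.A)ᴴ * s.Bᴴ := by
        rw [one_sub_A_mul_conjTranspose_A]
        simp only [Matrix.conjTranspose_mul, Matrix.conjTranspose_conjTranspose, hη,
          Matrix.mul_assoc, Matrix.neg_mul, Matrix.mul_neg, sub_eq_add_neg]

/-- The unitary matrix that carries the columns of the splitting `s` to those of `t`. -/
def transition : Matrix (Fin N) (Fin N) ℂ := t.A * s.Aᴴ + t.B * s.Bᴴ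

theorem transition_mul_A : s.transition t * s.A = t.A := by
  rw [transition, Matrix.add_mul, Matrix.mul_assoc, Matrix.mul_assoc, s.hAA, s.hBA, Matrix.mul_one,
    Matrix.mul_zero, add_zero]

theorem transition_mul_B : s.transition t * s.B = t.B := by
  rw [transition, Matrix.add_mul, Matrix.mul_assoc, Matrix.mul_assoc, s.hAB, s.hBB, Matrix.mul_one,
    Matrix.mul_zero, zero_add]

theorem transition_mul_conjTranspose : s.transition t * (s.transition t)ᴴ = 1 := by
  rw [show (s.transition t)ᴴ = s.A * t.Aᴴ + s.B * t.Bᴴ by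
      simp only [transition, Matrix.conjTranspose_add, Matrix.conjTranspose_mul,
        Matrix.conjTranspose_conjTranspose],
    Matrix.mul_add, ← Matrix.mul_assoc, ← Matrix.mul_assoc, transition_mul_A, transition_mul_B,
    t.hsum]

theorem transition_mul_A_mul_conjTranspose_A :
    s.transition t * (s.A * s.Aᴴ) * (s.transition t)ᴴ = t.A * t.Aᴴ := by
  rw [← Matrix.mul_assoc, transition_mul_A, Matrix.mul_assoc, ← Matrix.conjTranspose_mul,
    transition_mul_A]

end Splitting

/-! ### The orbit as an embedded submanifold -/

namespace Orbit

variable {d N : ℕ} [hN : Fact (d ≤ N)]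

theorem coord_splittingAt (ξ : Orbit d N) : ξ.splittingAt.coord ξ.incl = 0 := by
  rw [Splitting.coord, ξ.splittingAt_spec, Matrix.mul_smul, ← Matrix.mul_assoc, Splitting.hBA,
    Matrix.zero_mul, smul_zero, Matrix.zero_mul, Matrix.zero_mul]

theorem graphMatrix_splittingAt_zero (ξ : Orbit d N) : ξ.splittingAt.graphMatrix 0 = ξ.incl := by
  rw [Splitting.graphMatrix_eq_smul_graphProj, Splitting.graphProj_zero, ← ξ.splittingAt_spec]

variable [hd : Fact (0 < d)] {n : WithTop ℕ∞}

instance : IsManifold 𝓘(ℝ, OrbitModel d N) n (Orbit d N) := by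
  apply isManifold_of_contDiffOn
  rintro _ _ ⟨s, rfl⟩ ⟨t, rfl⟩
  simp only [modelWithCornersSelf_coe, modelWithCornersSelf_coe_symm, Function.id_comp,
    Function.comp_id, Set.preimage_id, Set.range_id, Set.inter_univ]
  exact t.contDiffOn_coord.comp s.contDiff_graphMatrix.contDiffOn fun _ hZ => hZ.2

theorem contMDiff_incl : ContMDiff 𝓘(ℝ, OrbitModel d N) 𝓘(ℝ, Matrix (Fin N) (Fin N) ℂ) n
    (incl : Orbit d N → Matrix (Fin N) (Fin N) ℂ) :=
  contMDiff_iff.2 ⟨continuous_incl, fun ξ _ =>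
    ξ.splittingAt.contDiff_graphMatrix.contDiffOn⟩

theorem mdifferentiableAt_incl (ξ : Orbit d N) : MDifferentiableAt 𝓘(ℝ, OrbitModel d N)
    𝓘(ℝ, Matrix (Fin N) (Fin N) ℂ) (incl : Orbit d N → Matrix (Fin N) (Fin N) ℂ) ξ :=
  contMDiff_incl.mdifferentiableAt (n := 1) one_ne_zero

theorem contMDiff_of_incl_comp {E H M : Type*} [NormedAddCommGroup E] [NormedSpace ℝ E]
    [TopologicalSpace H] {I : ModelWithCorners ℝ E H} [TopologicalSpace M] [ChartedSpace H M]
    {f : M → Orbit d N}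
    (hf : ContMDiff I 𝓘(ℝ, Matrix (Fin N) (Fin N) ℂ) n (fun x => (f x).incl)) :
    ContMDiff I 𝓘(ℝ, OrbitModel d N) n f := by
  have hc : Continuous f := Topology.IsInducing.subtypeVal.continuous_iff.2 hf.continuous
  intro x
  rw [contMDiffAt_iff_target]
  refine ⟨hc.continuousAt, ?_⟩
  have hcoord := (f x).splittingAt.contDiffOn_coord.contDiffAt (n := n)
    ((f x).splittingAt.isOpen_coord_domain.mem_nhds (mem_chart_source (OrbitModel d N) (f x)))
  exact ContMDiffAt.comp (f := fun x => (f x).incl) x hcoord.contMDiffAt (hf x)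

theorem tangentIncl_eq_fderiv (ξ : Orbit d N) (U : OrbitModel d N) :
    ξ.tangentIncl U = fderiv ℝ ξ.splittingAt.graphMatrix 0 U := by
  have h : ξ.tangentIncl = fderivWithin ℝ ξ.splittingAt.graphMatrix
      (Set.range 𝓘(ℝ, OrbitModel d N)) (ξ.splittingAt.coord ξ.incl) :=
    (mdifferentiableAt_incl ξ).mfderiv
  rw [coord_splittingAt, modelWithCornersSelf_coe, Set.range_id, fderivWithin_univ] at h
  exact DFunLike.congr_fun h U

theorem tangentIncl_eq_smul (ξ : Orbit d N) (U : OrbitModel d N) :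
    ξ.tangentIncl U = ((N : ℂ) / d) • (ξ.splittingAt.B * U * ξ.splittingAt.Aᴴ +
      ξ.splittingAt.A * Uᴴ * ξ.splittingAt.Bᴴ) := by
  rw [tangentIncl_eq_fderiv, Splitting.fderiv_graphMatrix, Splitting.slope_zero]
  simp only [Matrix.conjTranspose_mul, Matrix.conjTranspose_conjTranspose, Matrix.mul_assoc]

theorem conjTranspose_B_mul_tangentIncl_mul_A (ξ : Orbit d N) (U : OrbitModel d N) :
    ξ.splittingAt.Bᴴ * ξ.tangentIncl U * ξ.splittingAt.A = ((N : ℂ) / d) • U := by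
  rw [tangentIncl_eq_smul, Matrix.mul_smul, Matrix.smul_mul, Matrix.mul_add, Matrix.add_mul]
  simp only [← Matrix.mul_assoc, Splitting.hBB, Splitting.hBA, Matrix.one_mul, Matrix.zero_mul,
    add_zero]
  rw [Matrix.mul_assoc, Splitting.hAA, Matrix.mul_one]

theorem tangentIncl_injective (ξ : Orbit d N) : Function.Injective ξ.tangentIncl := by
  intro U V h
  have hBA := congrArg (fun X => ξ.splittingAt.Bᴴ * X * ξ.splittingAt.A) h
  have hUV := ((ξ.conjTranspose_B_mul_tangentIncl_mul_A U).symm.trans hBA).trans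
    (ξ.conjTranspose_B_mul_tangentIncl_mul_A V)
  exact smul_right_injective (OrbitModel d N) (Splitting.scale_ne_zero hd.out hN.out) hUV

theorem tangentIncl_eq_lie_slope (ξ : Orbit d N) (U : OrbitModel d N) :
    ξ.tangentIncl U =
      ⁅ξ.splittingAt.slope 0 U - (ξ.splittingAt.slope 0 U)ᴴ, ξ.incl⁆ := by
  rw [tangentIncl_eq_fderiv, Splitting.fderiv_graphMatrix_eq_lie, graphMatrix_splittingAt_zero]

theorem exists_lie_eq_tangentIncl (ξ : Orbit d N) (U : TangentSpace 𝓘(ℝ, OrbitModel d N) ξ) :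
    ∃ η : Matrix (Fin N) (Fin N) ℂ, ηᴴ = -η ∧ ξ.tangentIncl U = ⁅η, ξ.incl⁆ :=
  ⟨_, conjTranspose_sub_conjTranspose _, ξ.tangentIncl_eq_lie_slope U⟩

theorem exists_tangentIncl_eq_lie (ξ : Orbit d N) {η : Matrix (Fin N) (Fin N) ℂ} (hη : ηᴴ = -η) :
    ∃ U : TangentSpace 𝓘(ℝ, OrbitModel d N) ξ, ξ.tangentIncl U = ⁅η, ξ.incl⁆ := by
  refine ⟨(ξ.splittingAt.Bᴴ * η * ξ.splittingAt.A : OrbitModel d N),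
    (ξ.tangentIncl_eq_smul _).trans ?_⟩
  rw [← ξ.splittingAt.lie_A_mul_conjTranspose_A hη, ξ.splittingAt_spec, Ring.lie_def, Ring.lie_def,
    Matrix.mul_smul, Matrix.smul_mul, smul_sub]

theorem range_tangentIncl (ξ : Orbit d N) : Set.range ξ.tangentIncl =
    {X | ∃ η : Matrix (Fin N) (Fin N) ℂ, ηᴴ = -η ∧ X = ⁅η, ξ.incl⁆} := by
  ext X
  constructor
  · rintro ⟨U, rfl⟩
    exact ξ.exists_lie_eq_tangentIncl U
  · rintro ⟨η, hη, rfl⟩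
    exact ξ.exists_tangentIncl_eq_lie hη

theorem incl_unitary_smul (U : Matrix.unitaryGroup (Fin N) ℂ) (ξ : Orbit d N) :
    (U • ξ).incl = (U : Matrix (Fin N) (Fin N) ℂ) * ξ.incl * (U : Matrix (Fin N) (Fin N) ℂ)ᴴ := rfl

instance : MulAction.IsPretransitive (Matrix.unitaryGroup (Fin N) ℂ) (Orbit d N) where
  exists_smul_eq ξ ζ := by
    let s := ξ.splittingAt
    let t := ζ.splittingAt
    have hU : s.transition t ∈ Matrix.unitaryGroup (Fin N) ℂ :=
      Matrix.mem_unitaryGroup_iff.2 (s.transition_mul_conjTranspose t)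
    refine ⟨⟨s.transition t, hU⟩, Subtype.ext ?_⟩
    change s.transition t * ξ.incl * (s.transition t)ᴴ = ζ.incl
    rw [ξ.splittingAt_spec, ζ.splittingAt_spec, Matrix.mul_smul, Matrix.smul_mul,
      s.transition_mul_A_mul_conjTranspose_A t]

end Orbit

theorem isOrbitMatrix_diagonal {d N : ℕ} (hd : 0 < d) {S : Finset (Fin N)} (hS : S.card = d) :
    IsOrbitMatrix d N (Matrix.diagonal fun i => if i ∈ S then (N : ℂ) / d else 0) := by
  have hd' : (d : ℂ) ≠ 0 := by exact_mod_cast hd.ne'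
  have hdN : d ≤ N := hS ▸ (card_finset_fin_le S)
  refine (isOrbitMatrix_iff hd hdN _).2 ⟨?_, ?_, ?_⟩
  · rw [Matrix.isHermitian_diagonal_iff]
    intro i
    split_ifs <;> simp [IsSelfAdjoint]
  · rw [Matrix.diagonal_mul_diagonal, ← Matrix.diagonal_smul]
    congr 1
    ext i
    split_ifs with h <;> simp [h]
  · rw [Matrix.trace_diagonal, ← Finset.sum_filter, Finset.filter_univ_mem, Finset.sum_const, hS,
      nsmul_eq_mul, mul_div_cancel₀ _ hd']

namespace Orbit

variable {d N : ℕ}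

theorem isHermitian_incl (ξ : Orbit d N) : ξ.incl.IsHermitian :=
  ξ.2.elim fun h _ => h

variable [hd : Fact (0 < d)]

theorem exists_incl_eq_diagonal {S : Finset (Fin N)} (hS : S.card = d) :
    ∃ ξ : Orbit d N, ξ.incl = Matrix.diagonal fun i => if i ∈ S then (N : ℂ) / d else 0 :=
  ⟨⟨_, isOrbitMatrix_diagonal hd.out hS⟩, rfl⟩

variable [hN : Fact (d ≤ N)]

instance : Nonempty (Orbit d N) := by
  obtain ⟨S, -, hS⟩ := Finset.exists_subset_card_eq (s := (Finset.univ : Finset (Fin N)))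
    (by simpa using hN.out)
  exact (exists_incl_eq_diagonal hS).nonempty

theorem incl_mul_incl (ξ : Orbit d N) : ξ.incl * ξ.incl = ((N : ℂ) / d) • ξ.incl :=
  ((isOrbitMatrix_iff hd.out hN.out _).1 ξ.2).2.1

end Orbit

/-! ### The Kirillov–Kostant–Souriau form -/

theorem alphaPairing_lie {N : ℕ} (ξ : Matrix (Fin N) (Fin N) ℂ) {η η' : Matrix (Fin N) (Fin N) ℂ}
    (hη : ηᴴ = -η) (hη' : η'ᴴ = -η') :
    alphaPairing ξ ⁅η, η'⁆ = (-(Complex.I / 2) * (η * ⁅η', ξ⁆).trace).re := by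
  have h : (⁅η, η'⁆ᴴ * ξ).trace = -(η * ⁅η', ξ⁆).trace := by
    rw [conjTranspose_lie, hη, hη', Ring.lie_def, Ring.lie_def, Matrix.mul_sub, Matrix.trace_sub,
      ← Matrix.mul_assoc, ← Matrix.mul_assoc, Matrix.trace_mul_comm (η * ξ), ← Matrix.mul_assoc]
    simp only [Matrix.neg_mul, Matrix.mul_neg, neg_neg, Matrix.sub_mul, Matrix.trace_sub, neg_sub]
  rw [alphaPairing, h, mul_neg, neg_mul]

theorem alphaPairing_lie_swap {N : ℕ} (ξ η η' : Matrix (Fin N) (Fin N) ℂ) :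
    alphaPairing ξ ⁅η, η'⁆ = -alphaPairing ξ ⁅η', η⁆ := by
  simp only [alphaPairing, Ring.lie_def, Matrix.conjTranspose_sub, Matrix.sub_mul,
    Matrix.trace_sub, mul_sub, Complex.sub_re, neg_sub]

theorem alphaPairing_lie_congr {N : ℕ} {ξ η η' ζ ζ' : Matrix (Fin N) (Fin N) ℂ}
    (hη : ηᴴ = -η) (hη' : η'ᴴ = -η') (hζ : ζᴴ = -ζ) (hζ' : ζ'ᴴ = -ζ')
    (h : ⁅η, ξ⁆ = ⁅ζ, ξ⁆) (h' : ⁅η', ξ⁆ = ⁅ζ', ξ⁆) :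
    alphaPairing ξ ⁅η, η'⁆ = alphaPairing ξ ⁅ζ, ζ'⁆ := by
  rw [alphaPairing_lie ξ hη hη', h', ← alphaPairing_lie ξ hη hζ', alphaPairing_lie_swap,
    alphaPairing_lie ξ hζ' hη, h, ← alphaPairing_lie ξ hζ' hζ, ← alphaPairing_lie_swap]

namespace Orbit

variable {d N : ℕ}

theorem conjTranspose_lift (ξ : Orbit d N) {X : Matrix (Fin N) (Fin N) ℂ} (hX : X.IsHermitian) :
    (ξ.lift X)ᴴ = -ξ.lift X := by
  rw [lift, Matrix.conjTranspose_smul, conjTranspose_lie, hX.eq, ξ.isHermitian_incl.eq,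
    star_trivial, ← smul_neg, Ring.lie_def, Ring.lie_def, neg_sub]

variable [hd : Fact (0 < d)] [hN : Fact (d ≤ N)]

theorem lie_lift_lie (ξ : Orbit d N) (η : Matrix (Fin N) (Fin N) ℂ) :
    ⁅ξ.lift ⁅η, ξ.incl⁆, ξ.incl⁆ = ⁅η, ξ.incl⁆ := by
  have hscale : ((d : ℝ) / N) ^ 2 • ((N : ℂ) / d) ^ 2 = 1 := by
    rw [Complex.real_smul, Complex.ofReal_pow, Complex.ofReal_div, Complex.ofReal_natCast,
      Complex.ofReal_natCast, ← mul_pow, ← inv_div,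
      inv_mul_cancel₀ (Splitting.scale_ne_zero hd.out hN.out), one_pow]
  rw [lift, smul_lie_matrix, lie_lie_lie_of_mul_self_eq_smul ξ.incl_mul_incl, ← smul_assoc, hscale,
    one_smul]

theorem ambientKKS_lie (ξ : Orbit d N) {η η' : Matrix (Fin N) (Fin N) ℂ}
    (hη : ηᴴ = -η) (hη' : η'ᴴ = -η') :
    ξ.ambientKKS ![⁅η, ξ.incl⁆, ⁅η', ξ.incl⁆] = alphaPairing ξ.incl ⁅η, η'⁆ :=
  alphaPairing_lie_congr (ξ.conjTranspose_lift (isHermitian_lie hη ξ.isHermitian_incl))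
    (ξ.conjTranspose_lift (isHermitian_lie hη' ξ.isHermitian_incl)) hη hη' (ξ.lie_lift_lie η)
    (ξ.lie_lift_lie η')

theorem kksForm_apply (ξ : Orbit d N) (v w : TangentSpace 𝓘(ℝ, OrbitModel d N) ξ) :
    kksForm d N ξ ![v, w] = ξ.ambientKKS ![ξ.tangentIncl v, ξ.tangentIncl w] := rfl

theorem kksForm_eq_alphaPairing (ξ : Orbit d N) (v w : TangentSpace 𝓘(ℝ, OrbitModel d N) ξ)
    (η η' : Matrix (Fin N) (Fin N) ℂ) (hη : ηᴴ = -η) (hη' : η'ᴴ = -η')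
    (hv : ξ.tangentIncl v = ⁅η, ξ.incl⁆) (hw : ξ.tangentIncl w = ⁅η', ξ.incl⁆) :
    kksForm d N ξ ![v, w] = alphaPairing ξ.incl ⁅η, η'⁆ := by
  rw [kksForm_apply, hv, hw, ξ.ambientKKS_lie hη hη']

end Orbit

theorem isCoadjointOrbit (d N : ℕ) [Fact (0 < d)] [Fact (d ≤ N)] : IsCoadjointOrbit d N where
  isManifold := inferInstance
  smooth_incl := Orbit.contMDiff_incl
  injective := Orbit.tangentIncl_injective
  range_eq := Orbit.range_tangentIncl
  nonempty := inferInstance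
  transitive := inferInstance
  kks := Orbit.kksForm_eq_alphaPairing

/-! ### The Kirillov–Kostant–Souriau form is symplectic -/

section BilinearOneForm

variable {E F : Type*} [NormedAddCommGroup E] [NormedSpace ℝ E] [NormedAddCommGroup F]
  [NormedSpace ℝ F]

theorem isBoundedBilinearMap_continuousLinearMap_comp {G H : Type*} [NormedAddCommGroup G]
    [NormedSpace ℝ G] [NormedAddCommGroup H] [NormedSpace ℝ H] {B : F × E → G}
    (hB : IsBoundedBilinearMap ℝ B) (L : G →L[ℝ] H) :
    IsBoundedBilinearMap ℝ (fun p => L (B p)) :=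
  (L.compL ℝ E G H ∘L hB.toContinuousLinearMap).isBoundedBilinearMap

/-- The `1`-form `v ↦ B (f x, v)`. -/
def bilinearOneForm {B : F × E → ℝ} (hB : IsBoundedBilinearMap ℝ B) (f : E → F) (x : E) :
    E [⋀^Fin 1]→L[ℝ] ℝ :=
  ContinuousAlternatingMap.ofSubsingletonLIE (0 : Fin 1) (hB.toContinuousLinearMap (f x))

variable {B : F × E → ℝ} (hB : IsBoundedBilinearMap ℝ B) {f : E → F}

theorem contDiff_bilinearOneForm {n : WithTop ℕ∞} (hf : ContDiff ℝ n f) :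
    ContDiff ℝ n (bilinearOneForm hB f) :=
  (ContinuousAlternatingMap.ofSubsingletonLIE (𝕜 := ℝ) (E := E) (F := ℝ) (0 : Fin 1)).contDiff.comp
    (hB.toContinuousLinearMap.contDiff.comp hf)

theorem extDeriv_bilinearOneForm_apply {x : E} (hf : DifferentiableAt ℝ f x) (u v : E) :
    extDeriv (bilinearOneForm hB f) x ![u, v] =
      B (fderiv ℝ f x u, v) - B (fderiv ℝ f x v, u) := by
  have h : HasFDerivAt (bilinearOneForm hB f) _ x :=
    ((ContinuousAlternatingMap.ofSubsingletonLIE (𝕜 := ℝ) (E := E) (F := ℝ)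
      (0 : Fin 1)).toContinuousLinearEquiv.hasFDerivAt).comp x
      (hB.toContinuousLinearMap.hasFDerivAt.comp x hf.hasFDerivAt)
  rw [extDeriv, ContinuousAlternatingMap.alternatizeUncurryFin_apply, Fin.sum_univ_two, h.fderiv]
  simp [Fin.removeNth, sub_eq_add_neg]

end BilinearOneForm

theorem contDiff_extDeriv {E : Type*} [NormedAddCommGroup E] [NormedSpace ℝ E] {k : ℕ}
    {n m : WithTop ℕ∞} {α : E → E [⋀^Fin k]→L[ℝ] ℝ} (hα : ContDiff ℝ n α) (hmn : m + 1 ≤ n) :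
    ContDiff ℝ m (extDeriv α) := by
  have h : extDeriv α =
      fun x => ContinuousAlternatingMap.alternatizeUncurryFinCLM ℝ E ℝ (fderiv ℝ α x) := rfl
  rw [h]
  exact (ContinuousLinearMap.contDiff _).comp (hα.fderiv_right hmn)

theorem re_neg_I_div_two_mul_star_sub (c : ℝ) (z : ℂ) :
    (-(Complex.I / 2) * (c * (star z - z))).re = -c * z.im := by
  have h : star z - z = -(2 * z.im : ℝ) * Complex.I := by
    rw [← neg_sub, Complex.star_def, Complex.sub_conj, neg_mul]
  rw [h, show -(Complex.I / 2) * (c * (-(2 * z.im : ℝ) * Complex.I)) =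
    (Complex.I * Complex.I) * ((c * z.im : ℝ) : ℂ) by push_cast; ring, Complex.I_mul_I,
    neg_one_mul, Complex.neg_re, Complex.ofReal_re, neg_mul]

theorem trace_mul_conjTranspose_mul_mul_eq_star {l m R : Type*} [Fintype l] [Fintype m]
    [CommRing R] [StarRing R] {K : Matrix m m R} {L : Matrix l l R} (hK : K.IsHermitian)
    (hL : L.IsHermitian) (U V : Matrix l m R) :
    (K * Vᴴ * L * U).trace = star (K * Uᴴ * L * V).trace := by
  rw [← Matrix.trace_conjTranspose]
  simp only [Matrix.conjTranspose_mul, Matrix.conjTranspose_conjTranspose, hK.eq, hL.eq]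
  rw [Matrix.mul_assoc, Matrix.mul_assoc, Matrix.trace_mul_comm]
  simp only [Matrix.mul_assoc]

namespace Splitting

variable {d N : ℕ}

theorem alphaPairing_slope (s : Splitting d N) (Z U V : OrbitModel d N) :
    alphaPairing (s.graphMatrix Z) ⁅s.slope Z U - (s.slope Z U)ᴴ, s.slope Z V - (s.slope Z V)ᴴ⁆ =
      -((N : ℝ) / d) * (((s.slope Z U)ᴴ * s.slope Z V).trace).im := by
  have hUV : (s.slope Z U)ᴴ * (s.slope Z V)ᴴ = 0 := by
    rw [← Matrix.conjTranspose_mul, slope_mul_slope, Matrix.conjTranspose_zero]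
  have htrace : ((s.slope Z U - (s.slope Z U)ᴴ) * (s.slope Z V + (s.slope Z V)ᴴ)).trace =
      star ((s.slope Z U)ᴴ * s.slope Z V).trace - ((s.slope Z U)ᴴ * s.slope Z V).trace := by
    rw [← Matrix.trace_conjTranspose, Matrix.conjTranspose_mul, Matrix.conjTranspose_conjTranspose,
      Matrix.trace_mul_comm _ (s.slope Z U), ← Matrix.trace_sub, Matrix.sub_mul, Matrix.mul_add,
      Matrix.mul_add, slope_mul_slope, hUV, zero_add, add_zero]
  rw [alphaPairing_lie _ (conjTranspose_sub_conjTranspose _) (conjTranspose_sub_conjTranspose _),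
    ← fderiv_graphMatrix_eq_lie, fderiv_graphMatrix, Matrix.mul_smul, Matrix.trace_smul, htrace,
    ← re_neg_I_div_two_mul_star_sub, smul_eq_mul, Complex.ofReal_div, Complex.ofReal_natCast,
    Complex.ofReal_natCast]

variable (d N) in
/-- The pairing `(M, V) ↦ -(c / 2) Im tr (M V)`, where `c = N / d`. -/
def imTracePairing (p : Matrix (Fin d) (Fin (N - d)) ℂ × OrbitModel d N) : ℝ :=
  -((N : ℝ) / d / 2) * ((p.1 * p.2).trace).im

theorem isBoundedBilinearMap_imTracePairing : IsBoundedBilinearMap ℝ (imTracePairing d N) :=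
  isBoundedBilinearMap_continuousLinearMap_comp isBoundedBilinearMap_matrix_mul
    ((-((N : ℝ) / d / 2)) •
      (Complex.imCLM ∘L (Matrix.traceLinearMap (Fin d) ℝ ℂ).toContinuousLinearMap))

variable (d N) in
/-- A primitive of the Kirillov–Kostant–Souriau form, the same in all graph charts:
`V ↦ -(c / 2) Im tr ((1 + Zᴴ Z)⁻¹ Zᴴ V)`, where `c = N / d`. -/
def primitive : OrbitModel d N → OrbitModel d N [⋀^Fin 1]→L[ℝ] ℝ :=
  bilinearOneForm (isBoundedBilinearMap_imTracePairing (d := d) (N := N))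
    (fun Z => (1 + Zᴴ * Z)⁻¹ * Zᴴ)

theorem contDiff_inv_gram_mul_conjTranspose {n : WithTop ℕ∞} :
    ContDiff ℝ n (fun Z : OrbitModel d N => (1 + Zᴴ * Z)⁻¹ * Zᴴ) := by
  rw [← contDiffOn_univ]
  exact contDiffOn_matrix_mul contDiff_inv_gram.contDiffOn
    (contDiffOn_matrix_conjTranspose contDiffOn_id)

theorem contDiff_primitive {n : WithTop ℕ∞} : ContDiff ℝ n (primitive d N) :=
  contDiff_bilinearOneForm _ contDiff_inv_gram_mul_conjTranspose

theorem differentiableAt_inv_gram_mul_conjTranspose (Z : OrbitModel d N) :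
    DifferentiableAt ℝ (fun Z : OrbitModel d N => (1 + Zᴴ * Z)⁻¹ * Zᴴ) Z :=
  (contDiff_inv_gram_mul_conjTranspose (n := 1)).differentiable one_ne_zero Z

theorem fderiv_inv_gram_mul_conjTranspose (Z U : OrbitModel d N) :
    fderiv ℝ (fun Z : OrbitModel d N => (1 + Zᴴ * Z)⁻¹ * Zᴴ) Z U =
      (1 + Zᴴ * Z)⁻¹ * Uᴴ * (1 - Z * (1 + Zᴴ * Z)⁻¹ * Zᴴ) -
        (1 + Zᴴ * Z)⁻¹ * Zᴴ * U * ((1 + Zᴴ * Z)⁻¹ * Zᴴ) := by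
  refine fderiv_apply_eq_of_hasLineDerivAt (differentiableAt_inv_gram_mul_conjTranspose Z) ?_
  have hZ := hasLineDerivAt_id Z U
  have hZs := hasDerivAt_matrix_conjTranspose hZ
  have hK := hasDerivAt_matrix_inv ((hasDerivAt_matrix_mul hZs hZ).const_add 1) (isUnit_gram _)
  refine (hasDerivAt_matrix_mul hK hZs).congr_deriv ?_
  simp only [zero_smul, add_zero]
  simp only [Matrix.mul_add, Matrix.add_mul, Matrix.mul_sub, Matrix.mul_one, Matrix.neg_mul,
    Matrix.mul_assoc]
  abel

theorem extDeriv_primitive_apply (Z U V : OrbitModel d N) :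
    extDeriv (primitive d N) Z ![U, V] = -((N : ℝ) / d) *
      (((1 + Zᴴ * Z)⁻¹ * Uᴴ * (1 - Z * (1 + Zᴴ * Z)⁻¹ * Zᴴ) * V).trace).im := by
  have hK := isHermitian_inv_gram Z
  have hL : (1 - Z * (1 + Zᴴ * Z)⁻¹ * Zᴴ).IsHermitian :=
    Matrix.isHermitian_one.sub (Matrix.isHermitian_mul_mul_conjTranspose Z hK)
  have hsymm (M : Matrix (Fin d) (Fin (N - d)) ℂ) :
      (M * V * M * U).trace = (M * U * M * V).trace := by
    rw [Matrix.mul_assoc, Matrix.trace_mul_comm, ← Matrix.mul_assoc]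
  rw [primitive, extDeriv_bilinearOneForm_apply _ (differentiableAt_inv_gram_mul_conjTranspose Z),
    fderiv_inv_gram_mul_conjTranspose, fderiv_inv_gram_mul_conjTranspose]
  simp only [imTracePairing, Matrix.sub_mul _ _ U, Matrix.sub_mul _ _ V, Matrix.trace_sub, hsymm,
    trace_mul_conjTranspose_mul_mul_eq_star hK hL U V]
  simp only [Complex.sub_im, Complex.star_def, Complex.conj_im]
  ring

end Splitting

theorem TwoForm.inChart_apply {E M : Type*} [NormedAddCommGroup E] [NormedSpace ℝ E]
    [TopologicalSpace M] [ChartedSpace E M] (Ω : TwoForm E M) (p : M) (y u v : E) :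
    Ω.inChart p y ![u, v] = Ω ((chartAt E p).symm y)
      ![mfderiv 𝓘(ℝ, E) 𝓘(ℝ, E) (chartAt E p).symm y u,
        mfderiv 𝓘(ℝ, E) 𝓘(ℝ, E) (chartAt E p).symm y v] := by
  refine congrArg (Ω ((chartAt E p).symm y)) (funext fun i => ?_)
  fin_cases i <;> rfl

namespace Orbit

variable {d N : ℕ} [hd : Fact (0 < d)] [hN : Fact (d ≤ N)]

theorem tangentIncl_mfderiv_chartAt_symm (ξ : Orbit d N) (Z U : OrbitModel d N) :
    ((chartAt (OrbitModel d N) ξ).symm Z).tangentIncl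
      (mfderiv 𝓘(ℝ, OrbitModel d N) 𝓘(ℝ, OrbitModel d N) (chartAt (OrbitModel d N) ξ).symm Z U) =
    fderiv ℝ ξ.splittingAt.graphMatrix Z U := by
  have hsymm := mdifferentiableAt_atlas_symm (I := 𝓘(ℝ, OrbitModel d N)) (M := Orbit d N)
    (chart_mem_atlas (OrbitModel d N) ξ) (show Z ∈ (chartAt (OrbitModel d N) ξ).target from trivial)
  have hcomp := mfderiv_comp Z (mdifferentiableAt_incl ((chartAt (OrbitModel d N) ξ).symm Z)) hsymm
  have hgraph : mfderiv 𝓘(ℝ, OrbitModel d N) 𝓘(ℝ, Matrix (Fin N) (Fin N) ℂ)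
      ξ.splittingAt.graphMatrix Z = fderiv ℝ ξ.splittingAt.graphMatrix Z := mfderiv_eq_fderiv
  exact (DFunLike.congr_fun hcomp U).symm.trans (DFunLike.congr_fun hgraph U)

theorem kksForm_inChart (ξ : Orbit d N) :
    (kksForm d N).inChart ξ = extDeriv (Splitting.primitive d N) := by
  funext Z
  refine ContinuousAlternatingMap.ext fun v => ?_
  have hv : v = ![v 0, v 1] := by ext i; fin_cases i <;> rfl
  let p : Orbit d N := (chartAt (OrbitModel d N) ξ).symm Z
  have hp : p.incl = ξ.splittingAt.graphMatrix Z := rfl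
  have hvel (U : OrbitModel d N) : p.tangentIncl (mfderiv 𝓘(ℝ, OrbitModel d N)
      𝓘(ℝ, OrbitModel d N) (chartAt (OrbitModel d N) ξ).symm Z U) =
      ⁅ξ.splittingAt.slope Z U - (ξ.splittingAt.slope Z U)ᴴ, p.incl⁆ :=
    (tangentIncl_mfderiv_chartAt_symm ξ Z U).trans (Splitting.fderiv_graphMatrix_eq_lie _ _ _)
  rw [hv, Splitting.extDeriv_primitive_apply,
    ← Splitting.trace_conjTranspose_slope_mul_slope ξ.splittingAt, ← Splitting.alphaPairing_slope,
    ← hp]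
  exact (TwoForm.inChart_apply _ _ _ _ _).trans
    (kksForm_eq_alphaPairing p _ _ _ _ (conjTranspose_sub_conjTranspose _)
      (conjTranspose_sub_conjTranspose _) (hvel (v 0)) (hvel (v 1)))

theorem kksForm_eq_im_trace (ξ : Orbit d N) (U V : OrbitModel d N) :
    kksForm d N ξ ![U, V] = -((N : ℝ) / d) * ((Uᴴ * V).trace).im := by
  refine (kksForm_eq_alphaPairing ξ _ _ _ _ (conjTranspose_sub_conjTranspose _)
    (conjTranspose_sub_conjTranspose _) (ξ.tangentIncl_eq_lie_slope U)
    (ξ.tangentIncl_eq_lie_slope V)).trans ?_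
  rw [← graphMatrix_splittingAt_zero, Splitting.alphaPairing_slope,
    Splitting.trace_conjTranspose_slope_mul_slope]
  simp only [Matrix.mul_zero, add_zero, inv_one, Matrix.one_mul, Matrix.zero_mul, sub_zero,
    Matrix.mul_one]

open scoped ComplexOrder in
theorem kksForm_nondegenerate (ξ : Orbit d N) (X : TangentSpace 𝓘(ℝ, OrbitModel d N) ξ)
    (h : ∀ Y : TangentSpace 𝓘(ℝ, OrbitModel d N) ξ, kksForm d N ξ ![X, Y] = 0) : X = 0 := by
  let U : OrbitModel d N := X
  have hc : -((N : ℝ) / d) ≠ 0 := by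
    have hd0 : 0 < d := hd.out
    have hN0 : 0 < N := hd0.trans_le hN.out
    exact neg_ne_zero.2 (by positivity)
  have him (V : OrbitModel d N) : ((Uᴴ * V).trace).im = 0 :=
    (mul_eq_zero.1 ((ξ.kksForm_eq_im_trace U V).symm.trans (h V))).resolve_left hc
  have hre := him (Complex.I • U)
  rw [Matrix.mul_smul, Matrix.trace_smul, smul_eq_mul, Complex.I_mul_im] at hre
  exact Matrix.trace_conjTranspose_mul_self_eq_zero_iff.1 (Complex.ext hre (him U))

theorem isSymplectic_kksForm : IsSymplectic (kksForm d N) where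
  isManifold := inferInstance
  smooth ξ := by
    rw [kksForm_inChart]
    exact (contDiff_extDeriv (Splitting.contDiff_primitive (n := ∞)) le_rfl).contDiffOn
  closed ξ Z _ := by
    rw [kksForm_inChart]
    exact congrFun (extDeriv_extDeriv (r := ω) Splitting.contDiff_primitive le_top) Z
  nondegenerate := kksForm_nondegenerate

end Orbit

/-! ### Tight frames -/

namespace TightFrame

variable {d N : ℕ}

theorem continuous_mat : Continuous (mat : TightFrame d N → _) := continuous_subtype_val

instance : CompactSpace (TightFrame d N) := by
  have : ProperSpace (Matrix (Fin d) (Fin N) ℂ) := FiniteDimensional.proper ℂ _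
  refine isCompact_iff_compactSpace.1 (Metric.isCompact_of_isClosed_isBounded
    (s := {F : Matrix (Fin d) (Fin N) ℂ | F * Fᴴ = ((N : ℂ) / d) • (1 : Matrix (Fin d) (Fin d) ℂ)})
    ?_ ?_)
  · exact isClosed_eq (continuous_id.matrix_mul continuous_id.matrix_conjTranspose)
      continuous_const
  · refine isBounded_iff_forall_norm_le.2
      ⟨‖((N : ℂ) / d) • (1 : Matrix (Fin d) (Fin d) ℂ)‖ + 1, fun F hF => ?_⟩
    have h := Matrix.l2_opNorm_conjTranspose_mul_self Fᴴ
    rw [Matrix.conjTranspose_conjTranspose, hF, Matrix.l2_opNorm_conjTranspose] at h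
    rw [h]
    nlinarith [sq_nonneg (‖F‖ - 1)]

theorem star_scale_inv : star ((N : ℂ) / d)⁻¹ = ((N : ℂ) / d)⁻¹ := by simp

/-- A skew-Hermitian matrix whose commutator with `Fᴴ F` is the image `Xᴴ F + Fᴴ X` of the tangent
vector `X` under the differential of `F ↦ Fᴴ F`. -/
def generator (F : TightFrame d N) (X : Matrix (Fin d) (Fin N) ℂ) : Matrix (Fin N) (Fin N) ℂ :=
  ((N : ℂ) / d)⁻¹ • (Xᴴ * F.mat - F.matᴴ * X)

theorem conjTranspose_generator (F : TightFrame d N) (X : Matrix (Fin d) (Fin N) ℂ) :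
    (F.generator X)ᴴ = -F.generator X := by
  simp only [generator, Matrix.conjTranspose_smul, star_scale_inv, Matrix.conjTranspose_sub,
    Matrix.conjTranspose_mul, Matrix.conjTranspose_conjTranspose, ← smul_neg, neg_sub]

theorem IsTangent.mul_conjTranspose {F : TightFrame d N} {X : Matrix (Fin d) (Fin N) ℂ}
    (hX : F.IsTangent X) : F.mat * Xᴴ = -(X * F.matᴴ) :=
  eq_neg_of_add_eq_zero_right hX

theorem isTangent_neg_mul {F : TightFrame d N} {η : Matrix (Fin N) (Fin N) ℂ} (hη : ηᴴ = -η) :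
    F.IsTangent (-(F.mat * η)) := by
  simp [IsTangent, Matrix.conjTranspose_mul, hη, Matrix.mul_assoc]

variable [hd : Fact (0 < d)] [hN : Fact (d ≤ N)]

theorem incl_gram (F : TightFrame d N) : F.gram.incl = F.matᴴ * F.mat := rfl

theorem continuous_gram : Continuous (gram : TightFrame d N → Orbit d N) :=
  (continuous_mat.matrix_conjTranspose.matrix_mul continuous_mat).subtype_mk _

theorem gram_surjective : Function.Surjective (gram : TightFrame d N → Orbit d N) := by
  intro ξ
  obtain ⟨r, hstar, hr⟩ : ∃ r : ℂ, star r = r ∧ r * r = (N : ℂ) / d := by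
    refine ⟨(√((N : ℝ) / d) : ℝ), Complex.conj_ofReal _, ?_⟩
    rw [← Complex.ofReal_mul, Real.mul_self_sqrt (by positivity), Complex.ofReal_div,
      Complex.ofReal_natCast, Complex.ofReal_natCast]
  refine ⟨⟨r • ξ.splittingAt.Aᴴ, ?_⟩, Subtype.ext ?_⟩
  · rw [Matrix.conjTranspose_smul, hstar, Matrix.smul_mul, Matrix.mul_smul, smul_smul, hr,
      Matrix.conjTranspose_conjTranspose, ξ.splittingAt.hAA]
  · change (r • ξ.splittingAt.Aᴴ)ᴴ * (r • ξ.splittingAt.Aᴴ) = ξ.incl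
    rw [ξ.splittingAt_spec, Matrix.conjTranspose_smul, hstar, Matrix.smul_mul, Matrix.mul_smul,
      smul_smul, hr, Matrix.conjTranspose_conjTranspose]

theorem exists_unitary_smul_eq {F F' : TightFrame d N} (h : F.gram = F'.gram) :
    ∃ A : Matrix.unitaryGroup (Fin d) ℂ, A • F' = F := by
  have hc := Splitting.scale_ne_zero hd.out hN.out
  have hgram : F'.matᴴ * F'.mat = F.matᴴ * F.mat := congrArg Orbit.incl h.symm
  have hmul : ((N : ℂ) / d)⁻¹ • (F.mat * F'.matᴴ) * F'.mat = F.mat := by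
    rw [Matrix.smul_mul, Matrix.mul_assoc, hgram, ← Matrix.mul_assoc, F.mat_mul, Matrix.smul_mul,
      Matrix.one_mul, inv_smul_smul₀ hc]
  refine ⟨⟨((N : ℂ) / d)⁻¹ • (F.mat * F'.matᴴ), Matrix.mem_unitaryGroup_iff.2 ?_⟩,
    Subtype.ext hmul⟩
  rw [Matrix.star_eq_conjTranspose, Matrix.conjTranspose_smul, star_scale_inv,
    Matrix.conjTranspose_mul, Matrix.conjTranspose_conjTranspose, Matrix.mul_smul,
    ← Matrix.mul_assoc, hmul, F.mat_mul, inv_smul_smul₀ hc]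

theorem isHomeomorph_gramClass : IsHomeomorph (gramClass (d := d) (N := N)) := by
  have : T2Space (Orbit d N) := inferInstanceAs (T2Space {ξ // IsOrbitMatrix d N ξ})
  rw [isHomeomorph_iff_continuous_bijective]
  refine ⟨continuous_gram.quotient_lift _, ?_, ?_⟩
  · rintro ⟨F⟩ ⟨F'⟩ h
    exact Quotient.sound (exists_unitary_smul_eq h)
  · intro ξ
    obtain ⟨F, rfl⟩ := gram_surjective ξ
    exact ⟨Quotient.mk _ F, rfl⟩

theorem lie_generator {F : TightFrame d N} {X : Matrix (Fin d) (Fin N) ℂ} (hX : F.IsTangent X) :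
    ⁅F.generator X, F.gram.incl⁆ = Xᴴ * F.mat + F.matᴴ * X := by
  have h : (Xᴴ * F.mat - F.matᴴ * X) * (F.matᴴ * F.mat) -
      F.matᴴ * F.mat * (Xᴴ * F.mat - F.matᴴ * X) = ((N : ℂ) / d) • (Xᴴ * F.mat + F.matᴴ * X) := by
    calc _ = Xᴴ * (F.mat * F.matᴴ) * F.mat - F.matᴴ * (X * F.matᴴ) * F.mat -
          F.matᴴ * (F.mat * Xᴴ) * F.mat + F.matᴴ * (F.mat * F.matᴴ) * X := by
          simp only [Matrix.sub_mul, Matrix.mul_sub, Matrix.mul_assoc]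
          abel
      _ = _ := by
          rw [F.mat_mul, hX.mul_conjTranspose]
          simp only [Matrix.mul_smul, Matrix.smul_mul, Matrix.mul_one, Matrix.mul_neg,
            Matrix.neg_mul, smul_add]
          abel
  rw [generator, incl_gram, Ring.lie_def, Matrix.smul_mul, Matrix.mul_smul, ← smul_sub, h,
    inv_smul_smul₀ (Splitting.scale_ne_zero hd.out hN.out)]

theorem range_tangentIncl_gram (F : TightFrame d N) : Set.range F.gram.tangentIncl =
    {T | ∃ X, F.IsTangent X ∧ T = Xᴴ * F.mat + F.matᴴ * X} := by
  rw [Orbit.range_tangentIncl]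
  ext T
  constructor
  · rintro ⟨η, hη, rfl⟩
    refine ⟨_, isTangent_neg_mul hη, ?_⟩
    rw [incl_gram, Ring.lie_def, Matrix.conjTranspose_neg, Matrix.conjTranspose_mul, hη,
      Matrix.neg_mul, Matrix.neg_mul, Matrix.neg_mul, neg_neg, Matrix.mul_neg, sub_eq_add_neg,
      Matrix.mul_assoc, Matrix.mul_assoc]
  · rintro ⟨X, hX, rfl⟩
    exact ⟨F.generator X, F.conjTranspose_generator X, (lie_generator hX).symm⟩

theorem ker_gram (F : TightFrame d N) (X : Matrix (Fin d) (Fin N) ℂ) (hX : F.IsTangent X) :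
    Xᴴ * F.mat + F.matᴴ * X = 0 ↔
      ∃ η : Matrix (Fin d) (Fin d) ℂ, ηᴴ = -η ∧ X = η * F.mat := by
  constructor
  · intro h
    refine ⟨((N : ℂ) / d)⁻¹ • (X * F.matᴴ), ?_, ?_⟩
    · rw [Matrix.conjTranspose_smul, star_scale_inv, Matrix.conjTranspose_mul,
        Matrix.conjTranspose_conjTranspose, hX.mul_conjTranspose, smul_neg]
    · have hmul : F.mat * Xᴴ * F.mat + F.mat * F.matᴴ * X = 0 := by
        rw [Matrix.mul_assoc, Matrix.mul_assoc, ← Matrix.mul_add, h, Matrix.mul_zero]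
      rw [hX.mul_conjTranspose, F.mat_mul, Matrix.smul_mul, Matrix.one_mul, Matrix.neg_mul,
        neg_add_eq_zero] at hmul
      rw [Matrix.smul_mul, hmul, inv_smul_smul₀ (Splitting.scale_ne_zero hd.out hN.out)]
  · rintro ⟨η, hη, rfl⟩
    simp [Matrix.conjTranspose_mul, hη, Matrix.mul_assoc]

theorem trace_generator_mul {F : TightFrame d N} {X Y : Matrix (Fin d) (Fin N) ℂ}
    (hX : F.IsTangent X) (hY : F.IsTangent Y) :
    (F.generator X * (Yᴴ * F.mat + F.matᴴ * Y)).trace =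
      star (Yᴴ * X).trace - (Yᴴ * X).trace := by
  have hcross : (Xᴴ * F.mat * (Yᴴ * F.mat)).trace = (F.matᴴ * X * (F.matᴴ * Y)).trace := by
    calc _ = ((F.mat * Xᴴ) * (F.mat * Yᴴ)).trace := by
          rw [← Matrix.mul_assoc, Matrix.trace_mul_comm]
          simp only [Matrix.mul_assoc]
      _ = ((Y * F.matᴴ) * (X * F.matᴴ)).trace := by
          rw [hX.mul_conjTranspose, hY.mul_conjTranspose, neg_mul_neg, Matrix.trace_mul_comm]
      _ = _ := by
          rw [Matrix.mul_assoc, Matrix.trace_mul_comm]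
          simp only [Matrix.mul_assoc]
  have hstar : (Xᴴ * F.mat * (F.matᴴ * Y)).trace = (N : ℂ) / d * star (Yᴴ * X).trace := by
    rw [Matrix.mul_assoc, ← Matrix.mul_assoc F.mat, F.mat_mul, Matrix.smul_mul, Matrix.mul_smul,
      Matrix.trace_smul, Matrix.one_mul, smul_eq_mul, ← Matrix.trace_conjTranspose,
      Matrix.conjTranspose_mul, Matrix.conjTranspose_conjTranspose]
  have hself : (F.matᴴ * X * (Yᴴ * F.mat)).trace = (N : ℂ) / d * (Yᴴ * X).trace := by
    rw [Matrix.trace_mul_comm, Matrix.mul_assoc, ← Matrix.mul_assoc F.mat, F.mat_mul,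
      Matrix.smul_mul, Matrix.mul_smul, Matrix.trace_smul, Matrix.one_mul, smul_eq_mul]
  rw [generator, Matrix.smul_mul, Matrix.trace_smul, smul_eq_mul, Matrix.sub_mul, Matrix.mul_add,
    Matrix.mul_add, Matrix.trace_sub, Matrix.trace_add, Matrix.trace_add, hcross, hstar, hself,
    add_comm, add_sub_add_right_eq_sub, ← mul_sub,
    inv_mul_cancel_left₀ (Splitting.scale_ne_zero hd.out hN.out)]

theorem alphaPairing_generator {F : TightFrame d N} {X Y : Matrix (Fin d) (Fin N) ℂ}
    (hX : F.IsTangent X) (hY : F.IsTangent Y) :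
    alphaPairing F.gram.incl ⁅F.generator X, F.generator Y⁆ = -((Yᴴ * X).trace).im := by
  have h := re_neg_I_div_two_mul_star_sub 1 (Yᴴ * X).trace
  rwa [Complex.ofReal_one, one_mul, neg_one_mul, ← trace_generator_mul hX hY, ← lie_generator hY,
    ← alphaPairing_lie _ (F.conjTranspose_generator X) (F.conjTranspose_generator Y)] at h

theorem kksForm_gram (F : TightFrame d N) (X Y : Matrix (Fin d) (Fin N) ℂ)
    (hX : F.IsTangent X) (hY : F.IsTangent Y) (v w : TangentSpace 𝓘(ℝ, OrbitModel d N) F.gram)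
    (hv : F.gram.tangentIncl v = Xᴴ * F.mat + F.matᴴ * X)
    (hw : F.gram.tangentIncl w = Yᴴ * F.mat + F.matᴴ * Y) :
    Orbit.kksForm d N F.gram ![v, w] = -((Yᴴ * X).trace).im := by
  rw [← lie_generator hX] at hv
  rw [← lie_generator hY] at hw
  rw [Orbit.kksForm_eq_alphaPairing F.gram v w _ _ (F.conjTranspose_generator X)
    (F.conjTranspose_generator Y) hv hw, alphaPairing_generator hX hY]

theorem gram_torusAct (g : Fin N → Circle) (F : TightFrame d N) :
    (F.torusAct g).gram = torusToUnitary N g • F.gram := by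
  refine Subtype.ext ?_
  change (F.mat * (torusToUnitary N g : Matrix (Fin N) (Fin N) ℂ)ᴴ)ᴴ *
    (F.mat * (torusToUnitary N g : Matrix (Fin N) (Fin N) ℂ)ᴴ) =
    (torusToUnitary N g : Matrix (Fin N) (Fin N) ℂ) * (F.matᴴ * F.mat) *
      (torusToUnitary N g : Matrix (Fin N) (Fin N) ℂ)ᴴ
  simp only [Matrix.conjTranspose_mul, Matrix.conjTranspose_conjTranspose, Matrix.mul_assoc]

theorem momentum_gram {n : ℕ} [Fact (d ≤ n + 1)] (F : TightFrame d (n + 1)) (k : Fin n) :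
    F.gram.momentum k = ‖WithLp.toLp 2 (fun i => F.mat i k.castSucc)‖ ^ 2 := by
  rw [EuclideanSpace.norm_sq_eq, Orbit.momentum, incl_gram, Matrix.mul_apply, Complex.re_sum]
  refine Finset.sum_congr rfl fun i _ => ?_
  rw [Matrix.conjTranspose_apply, ← Complex.normSq_eq_norm_sq]
  simp [Complex.normSq_apply]

theorem gramIsSymplectomorphism : GramIsSymplectomorphism d N where
  isHomeomorph := isHomeomorph_gramClass
  equivariant := gram_torusAct
  range_eq := range_tangentIncl_gram
  ker_eq := ker_gram
  pullback := kksForm_gram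

end TightFrame

/-! ### Unitary invariance and the torus action -/

section MFDeriv

variable {E E' H M F : Type*} [NormedAddCommGroup E] [NormedSpace ℝ E] [NormedAddCommGroup E']
  [NormedSpace ℝ E'] [TopologicalSpace H] {I : ModelWithCorners ℝ E' H} [TopologicalSpace M]
  [ChartedSpace H M] [NormedAddCommGroup F] [NormedSpace ℝ F]

theorem mfderiv_comp_apply_of_hasFDerivAt {f : M → E} {x : M} {g : E → F} {g' : E →L[ℝ] F}
    (hg : HasFDerivAt g g' (f x)) (hf : MDifferentiableAt I 𝓘(ℝ, E) f x)
    (v : TangentSpace I x) :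
    (mfderiv I 𝓘(ℝ, F) (fun y => g (f y)) x v : F) = g' (mfderiv I 𝓘(ℝ, E) f x v : E) :=
  DFunLike.congr_fun (hg.hasMFDerivAt.comp x hf.hasMFDerivAt).mfderiv v

theorem mfderiv_apply_congr {f f' : M → F} (h : f = f') (x : M) (v : TangentSpace I x) :
    (mfderiv I 𝓘(ℝ, F) f x v : F) = (mfderiv I 𝓘(ℝ, F) f' x v : F) := by
  subst h
  rfl

theorem mfderiv_const_apply (c : F) (x : M) (v : TangentSpace I x) :
    (mfderiv I 𝓘(ℝ, F) (fun _ : M => c) x v : F) = 0 := by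
  rw [mfderiv_const]
  rfl

end MFDeriv

section Conjugate

variable {l m R : Type*} [Fintype m] [Ring R] [StarRing R] {V : Matrix l m R}

theorem conjTranspose_conjugate (V : Matrix l m R) (P : Matrix m m R) :
    (V * P * Vᴴ)ᴴ = V * Pᴴ * Vᴴ := by
  rw [Matrix.conjTranspose_mul, Matrix.conjTranspose_mul, Matrix.conjTranspose_conjTranspose,
    Matrix.mul_assoc]

theorem conjTranspose_conjugate_eq_neg (V : Matrix l m R) {P : Matrix m m R} (hP : Pᴴ = -P) :
    (V * P * Vᴴ)ᴴ = -(V * P * Vᴴ) := by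
  rw [conjTranspose_conjugate, hP, Matrix.mul_neg, Matrix.neg_mul]

variable [Fintype l] [DecidableEq m]

theorem conjugate_mul_conjugate (hV : Vᴴ * V = 1) (P Q : Matrix m m R) :
    V * P * Vᴴ * (V * Q * Vᴴ) = V * (P * Q) * Vᴴ := by
  calc V * P * Vᴴ * (V * Q * Vᴴ) = V * P * (Vᴴ * V) * Q * Vᴴ := by simp only [Matrix.mul_assoc]
    _ = V * (P * Q) * Vᴴ := by rw [hV, Matrix.mul_one, Matrix.mul_assoc V]

theorem conjugate_lie (hV : Vᴴ * V = 1) (P Q : Matrix m m R) :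
    V * ⁅P, Q⁆ * Vᴴ = ⁅V * P * Vᴴ, V * Q * Vᴴ⁆ := by
  simp only [Ring.lie_def, Matrix.mul_sub, Matrix.sub_mul, conjugate_mul_conjugate hV]

end Conjugate

theorem alphaPairing_conjugate {N : ℕ} {V : Matrix (Fin N) (Fin N) ℂ} (hV : Vᴴ * V = 1)
    (ξ η : Matrix (Fin N) (Fin N) ℂ) :
    alphaPairing (V * ξ * Vᴴ) (V * η * Vᴴ) = alphaPairing ξ η := by
  rw [alphaPairing, alphaPairing, conjTranspose_conjugate, conjugate_mul_conjugate hV,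
    Matrix.trace_mul_comm, ← Matrix.mul_assoc, hV, Matrix.one_mul]

/-- Conjugation `X ↦ V X Vᴴ` as a continuous linear map. -/
def conjugationCLM {m : Type*} [Fintype m] (V : Matrix m m ℂ) :
    Matrix m m ℂ →L[ℝ] Matrix m m ℂ where
  toFun X := V * X * Vᴴ
  map_add' X Y := by rw [Matrix.mul_add, Matrix.add_mul]
  map_smul' c X := by rw [Matrix.mul_smul, Matrix.smul_mul, RingHom.id_apply]
  cont := (continuous_const.matrix_mul continuous_id).matrix_mul continuous_const

theorem circle_coe_mul_star_coe (z : Circle) : (z : ℂ) * star (z : ℂ) = 1 := by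
  rw [← starRingEnd_apply, Complex.mul_conj, Circle.normSq_coe, Complex.ofReal_one]

namespace Orbit

variable {d N : ℕ} [hd : Fact (0 < d)] [hN : Fact (d ≤ N)]

theorem mfderiv_clm_comp_incl {F : Type*} [NormedAddCommGroup F] [NormedSpace ℝ F]
    (L : Matrix (Fin N) (Fin N) ℂ →L[ℝ] F) (ξ : Orbit d N)
    (X : TangentSpace 𝓘(ℝ, OrbitModel d N) ξ) :
    (mfderiv 𝓘(ℝ, OrbitModel d N) 𝓘(ℝ, F) (fun ζ : Orbit d N => L ζ.incl) ξ X : F) =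
      L (ξ.tangentIncl X) :=
  mfderiv_comp_apply_of_hasFDerivAt L.hasFDerivAt (mdifferentiableAt_incl ξ) X

theorem contMDiff_unitary_smul {n : WithTop ℕ∞} (U : Matrix.unitaryGroup (Fin N) ℂ) :
    ContMDiff 𝓘(ℝ, OrbitModel d N) 𝓘(ℝ, OrbitModel d N) n (fun ξ : Orbit d N => U • ξ) :=
  contMDiff_of_incl_comp ((conjugationCLM (U : Matrix (Fin N) (Fin N) ℂ)).contMDiff.comp
    contMDiff_incl)

theorem tangentIncl_mfderiv_unitary_smul (U : Matrix.unitaryGroup (Fin N) ℂ) (ξ : Orbit d N)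
    (X : TangentSpace 𝓘(ℝ, OrbitModel d N) ξ) :
    (U • ξ).tangentIncl (mfderiv 𝓘(ℝ, OrbitModel d N) 𝓘(ℝ, OrbitModel d N)
      (fun ξ : Orbit d N => U • ξ) ξ X) =
    (U : Matrix (Fin N) (Fin N) ℂ) * ξ.tangentIncl X * (U : Matrix (Fin N) (Fin N) ℂ)ᴴ :=
  (mfderiv_comp_apply ξ (mdifferentiableAt_incl (U • ξ))
    ((contMDiff_unitary_smul (n := 1) U ξ).mdifferentiableAt one_ne_zero) X).symm.trans
    (mfderiv_clm_comp_incl (conjugationCLM (U : Matrix (Fin N) (Fin N) ℂ)) ξ X)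

theorem kksForm_unitary_smul (U : Matrix.unitaryGroup (Fin N) ℂ) (ξ : Orbit d N)
    (X Y : TangentSpace 𝓘(ℝ, OrbitModel d N) ξ) :
    kksForm d N (U • ξ) ![mfderiv 𝓘(ℝ, OrbitModel d N) 𝓘(ℝ, OrbitModel d N)
      (fun ξ : Orbit d N => U • ξ) ξ X, mfderiv 𝓘(ℝ, OrbitModel d N) 𝓘(ℝ, OrbitModel d N)
      (fun ξ : Orbit d N => U • ξ) ξ Y] = kksForm d N ξ ![X, Y] := by
  obtain ⟨η, hη, hX⟩ := ξ.exists_lie_eq_tangentIncl X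
  obtain ⟨η', hη', hY⟩ := ξ.exists_lie_eq_tangentIncl Y
  have hU : (U : Matrix (Fin N) (Fin N) ℂ)ᴴ * U = 1 := Unitary.coe_star_mul_self U
  have hUX := tangentIncl_mfderiv_unitary_smul U ξ X
  have hUY := tangentIncl_mfderiv_unitary_smul U ξ Y
  rw [hX, conjugate_lie hU] at hUX
  rw [hY, conjugate_lie hU] at hUY
  rw [kksForm_eq_alphaPairing ξ X Y _ _ hη hη' hX hY,
    kksForm_eq_alphaPairing (U • ξ) _ _ _ _ (conjTranspose_conjugate_eq_neg _ hη)
      (conjTranspose_conjugate_eq_neg _ hη') hUX hUY,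
    ← conjugate_lie hU, incl_unitary_smul, alphaPairing_conjugate hU]

theorem torus_smul_apply (g : Fin N → Circle) (ξ : Orbit d N) (i j : Fin N) :
    (torusToUnitary N g • ξ).incl i j = (g i : ℂ) * ξ.incl i j * star (g j : ℂ) := by
  rw [incl_unitary_smul]
  change (Matrix.diagonal (fun k => (g k : ℂ)) * ξ.incl *
    (Matrix.diagonal fun k => (g k : ℂ))ᴴ) i j = _
  rw [Matrix.diagonal_conjTranspose, Matrix.mul_diagonal, Matrix.diagonal_mul, Pi.star_apply]

theorem scalarTorus_smul (g : Fin N → Circle) (hg : g ∈ scalarTorus N) (ξ : Orbit d N) :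
    torusToUnitary N g • ξ = ξ := by
  obtain ⟨z, rfl⟩ := hg
  refine Subtype.ext (Matrix.ext fun i j => (torus_smul_apply _ ξ i j).trans ?_)
  change (z : ℂ) * ξ.incl i j * star (z : ℂ) = ξ.incl i j
  rw [mul_right_comm, circle_coe_mul_star_coe, one_mul]

theorem exists_incl_apply_ne_zero (hdN : d < N) {i j : Fin N} (hij : i ≠ j) :
    ∃ ξ : Orbit d N, ξ.incl i j ≠ 0 := by
  by_contra! hzero
  have htangent (ξ : Orbit d N) (U : TangentSpace 𝓘(ℝ, OrbitModel d N) ξ) :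
      ξ.tangentIncl U i j = 0 :=
    (mfderiv_clm_comp_incl (Matrix.entryLinearMap ℝ ℂ i j).toContinuousLinearMap ξ U).symm.trans
      ((mfderiv_apply_congr (funext hzero) ξ U).trans (mfderiv_const_apply 0 ξ U))
  have hcard : d ≤ (Finset.univ.erase j).card := by
    rw [Finset.card_erase_of_mem (Finset.mem_univ j), Finset.card_univ, Fintype.card_fin]
    exact Nat.le_sub_one_of_lt hdN
  obtain ⟨S, hiS, hSj, hS⟩ := Finset.exists_subsuperset_card_eq
    (Finset.singleton_subset_iff.2 (Finset.mem_erase.2 ⟨hij, Finset.mem_univ i⟩))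
    ((Finset.card_singleton i).trans_le hd.out) hcard
  obtain ⟨ξ, hξ⟩ := exists_incl_eq_diagonal hS
  obtain ⟨U, hU⟩ :=
    ξ.exists_tangentIncl_eq_lie (conjTranspose_sub_conjTranspose (Matrix.single i j (1 : ℂ)))
  have hi : i ∈ S := Finset.singleton_subset_iff.1 hiS
  have hj : j ∉ S := fun h => (Finset.mem_erase.1 (hSj h)).1 rfl
  have hentry := htangent ξ U
  rw [hU, hξ, Ring.lie_def, Matrix.sub_apply, Matrix.mul_diagonal, Matrix.diagonal_mul, if_pos hi,
    if_neg hj, Matrix.sub_apply, Matrix.conjTranspose_single, Matrix.single_apply_same,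
    Matrix.single_apply_of_ne _ _ _ _ _ (fun h => hij h.2), mul_zero, zero_sub, sub_zero, mul_one,
    neg_eq_zero] at hentry
  exact Splitting.scale_ne_zero hd.out hN.out hentry

end Orbit

/-! ### The Lie algebra of the effective torus -/

theorem lieAd_eq_self {E H G : Type*} [NormedAddCommGroup E] [NormedSpace ℝ E]
    [TopologicalSpace H] (I : ModelWithCorners ℝ E H) [CommGroup G] [TopologicalSpace G]
    [ChartedSpace H G] (g : G) (v : GroupLieAlgebra I G) : lieAd I g v = v := by
  have h (f : G → G) (hf : f = id) : (mfderiv I I f 1 v : E) = v := by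
    subst hf
    rw [mfderiv_id]
    rfl
  exact h _ (funext (mul_inv_cancel_comm g))

theorem finrank_continuousDual (𝕜 E : Type*) [NontriviallyNormedField 𝕜] [CompleteSpace 𝕜]
    [NormedAddCommGroup E] [NormedSpace 𝕜 E] [FiniteDimensional 𝕜 E] :
    Module.finrank 𝕜 (E →L[𝕜] 𝕜) = Module.finrank 𝕜 E :=
  (LinearMap.toContinuousLinearMap (𝕜 := 𝕜) (E := E) (F' := 𝕜)).finrank_eq.symm.trans
    Subspace.dual_finrank_eq

namespace EffTorus

variable {n : ℕ}

theorem contMDiff_coe_apply (k : Fin n) :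
    ContMDiff (torusModel (Fin n)) 𝓘(ℝ, ℂ) ∞ (fun g : EffTorus n => (g k : ℂ)) := by
  have : Fact (Module.finrank ℝ ℂ = 1 + 1) := finrank_real_complex_fact'
  have h : ContMDiff (𝓡 1) 𝓘(ℝ, ℂ) ∞ (fun z : Circle => (z : ℂ)) :=
    contMDiff_coe_sphere (E := ℂ) (n := 1)
  exact h.comp (contMDiff_torus_apply k)

theorem mdifferentiableAt_coe_apply (k : Fin n) (g : EffTorus n) :
    MDifferentiableAt (torusModel (Fin n)) 𝓘(ℝ, ℂ) (fun g : EffTorus n => (g k : ℂ)) g :=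
  (contMDiff_coe_apply k g).mdifferentiableAt (by simp)

theorem mfderiv_coe_apply_one (k : Fin n) (v : GroupLieAlgebra (torusModel (Fin n)) (EffTorus n)) :
    (mfderiv (torusModel (Fin n)) 𝓘(ℝ, ℂ) (fun g : EffTorus n => (g k : ℂ)) 1 v : ℂ) =
      Complex.I * ((angle k v : ℝ) : ℂ) := by
  have hnorm_sq : HasFDerivAt (fun z : ℂ => ‖z‖ ^ 2) ((2 : ℝ) • Complex.reCLM)
      (((1 : EffTorus n) k : ℂ)) := by
    refine (hasFDerivAt_id (𝕜 := ℝ) (((1 : EffTorus n) k : ℂ))).norm_sq.congr_fderiv ?_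
    ext z
    simp
  have hone : (fun g : EffTorus n => ‖(g k : ℂ)‖ ^ 2) = fun _ => (1 : ℝ) := by
    funext g
    rw [Circle.norm_coe, one_pow]
  have hre : (0 : ℝ) = 2 * (mfderiv (torusModel (Fin n)) 𝓘(ℝ, ℂ)
      (fun g : EffTorus n => (g k : ℂ)) 1 v : ℂ).re :=
    (mfderiv_const_apply 1 1 v).symm.trans ((mfderiv_apply_congr hone 1 v).symm.trans
      (mfderiv_comp_apply_of_hasFDerivAt (f := fun g : EffTorus n => (g k : ℂ)) (x := 1) hnorm_sq
        (mdifferentiableAt_coe_apply k 1) v))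
  refine Complex.ext ?_ ?_
  · rw [Complex.I_mul_re, Complex.ofReal_im]
    linarith
  · rw [Complex.I_mul_im, Complex.ofReal_re]
    rfl

/-- The one-parameter group that rotates the `j`-th entry. -/
def rotation (j : Fin n) (t : ℝ) : EffTorus n := Pi.mulSingle j (Circle.exp t)

theorem contMDiff_rotation (j : Fin n) :
    ContMDiff 𝓘(ℝ, ℝ) (torusModel (Fin n)) ∞ (rotation j) := by
  rw [contMDiff_torus_iff]
  intro i
  by_cases h : i = j
  · subst h
    simpa [rotation] using contMDiff_circleExp
  · simpa [rotation, h] using contMDiff_const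

theorem deriv_coe_rotation_apply (k j : Fin n) :
    deriv (fun t : ℝ => ((rotation j t k : Circle) : ℂ)) 0 = if k = j then Complex.I else 0 := by
  split_ifs with hkj
  · subst hkj
    have hexp := (Complex.hasDerivAt_exp ((0 : ℝ) * Complex.I)).comp_of_eq (0 : ℝ)
      ((Complex.ofRealCLM.hasDerivAt (x := (0 : ℝ))).mul_const Complex.I) rfl
    simp only [rotation, Pi.mulSingle_eq_same, Circle.coe_exp]
    exact (hexp.congr_deriv (by simp)).deriv
  · simp [rotation, hkj]

/-- The velocity of `rotation j` at `0`, an element of the Lie algebra. -/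
def rotationGenerator (j : Fin n) : GroupLieAlgebra (torusModel (Fin n)) (EffTorus n) :=
  (mfderiv 𝓘(ℝ, ℝ) (torusModel (Fin n)) (rotation j) 0 (1 : ℝ) : Fin n → EuclideanSpace ℝ (Fin 1))

theorem angle_rotationGenerator (k j : Fin n) :
    angle k (rotationGenerator j) = if k = j then 1 else 0 := by
  have hzero : rotation j 0 = 1 := by rw [rotation, Circle.exp_zero, Pi.mulSingle_one]
  have hchain := mfderiv_comp_apply_of_eq (x := (0 : ℝ)) (mdifferentiableAt_coe_apply k 1)
    ((contMDiff_rotation j 0).mdifferentiableAt (by simp)) hzero (1 : ℝ)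
  have him : angle k (rotationGenerator j) =
      (fderiv ℝ (fun t : ℝ => ((rotation j t k : Circle) : ℂ)) 0 1).im := by
    rw [← mfderiv_eq_fderiv]
    exact congrArg Complex.im hchain.symm
  rw [him, fderiv_apply_one_eq_deriv, deriv_coe_rotation_apply, apply_ite Complex.im, Complex.I_im,
    Complex.zero_im]

theorem dualOfCoords_apply (x : Fin n → ℝ)
    (v : GroupLieAlgebra (torusModel (Fin n)) (EffTorus n)) :
    dualOfCoords n x v = 1 / 2 * ∑ k, x k * angle k v := by
  simp [dualOfCoords]

variable (n) in
/-- `dualOfCoords` as a linear map. -/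
def dualOfCoordsLinearMap :
    (Fin n → ℝ) →ₗ[ℝ] (GroupLieAlgebra (torusModel (Fin n)) (EffTorus n) →L[ℝ] ℝ) where
  toFun := dualOfCoords n
  map_add' x y := by simp [dualOfCoords, add_smul, Finset.sum_add_distrib]
  map_smul' c x := by
    simp only [dualOfCoords, Pi.smul_apply, smul_assoc, ← Finset.smul_sum, RingHom.id_apply]
    rw [smul_comm]

theorem dualOfCoords_injective : Function.Injective (dualOfCoords n) := by
  intro x y h
  funext j
  simpa [dualOfCoords_apply, angle_rotationGenerator] using
    DFunLike.congr_fun h (rotationGenerator j)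

theorem dualOfCoords_bijective : Function.Bijective (dualOfCoords n) := by
  refine ⟨dualOfCoords_injective, ?_⟩
  have hfinrank :
      Module.finrank ℝ (GroupLieAlgebra (torusModel (Fin n)) (EffTorus n) →L[ℝ] ℝ) = n :=
    (finrank_continuousDual ℝ (Fin n → EuclideanSpace ℝ (Fin 1))).trans
      (by simp [Module.finrank_pi_fintype])
  have : FiniteDimensional ℝ (GroupLieAlgebra (torusModel (Fin n)) (EffTorus n) →L[ℝ] ℝ) :=
    inferInstanceAs (FiniteDimensional ℝ ((Fin n → EuclideanSpace ℝ (Fin 1)) →L[ℝ] ℝ))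
  exact (LinearMap.injective_iff_surjective_of_finrank_eq_finrank (f := dualOfCoordsLinearMap n)
    (by rw [hfinrank, Module.finrank_fin_fun])).1 dualOfCoords_injective

theorem incl_castSucc (g : EffTorus n) (k : Fin n) : incl n g k.castSucc = g k :=
  Fin.snoc_castSucc (α := fun _ => Circle) ..

theorem incl_last (g : EffTorus n) : incl n g (Fin.last n) = 1 :=
  Fin.snoc_last (α := fun _ => Circle) ..

theorem mk_incl_bijective : Function.Bijective (fun g : EffTorus n =>
    (QuotientGroup.mk (incl n g) : (Fin (n + 1) → Circle) ⧸ scalarTorus (n + 1))) := by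
  constructor
  · intro g h hgh
    obtain ⟨z, hz⟩ := QuotientGroup.eq.1 hgh
    have hlast := congrFun hz (Fin.last n)
    have hz_one : z = 1 := by simpa [incl_last] using hlast
    funext k
    have hk := congrFun hz k.castSucc
    simp only [Pi.constMonoidHom_apply, Function.const_apply, Pi.mul_apply, Pi.inv_apply,
      incl_castSucc, hz_one] at hk
    exact inv_mul_eq_one.1 hk.symm
  · intro q
    obtain ⟨x, rfl⟩ := QuotientGroup.mk_surjective q
    refine ⟨fun k => x k.castSucc * (x (Fin.last n))⁻¹, QuotientGroup.eq.2 ⟨x (Fin.last n), ?_⟩⟩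
    funext k
    refine Fin.lastCases ?_ (fun i => ?_) k
    · simp [incl_last]
    · simp [incl_castSucc]

variable (n) in
/-- The diagonal matrix of an element of `G`. -/
def toMatrix (g : EffTorus n) : Matrix (Fin (n + 1)) (Fin (n + 1)) ℂ :=
  Matrix.diagonal fun k => (incl n g k : ℂ)

theorem toMatrix_one : toMatrix n 1 = 1 := by
  simp [toMatrix]

theorem contMDiff_coe_incl :
    ContMDiff (torusModel (Fin n)) 𝓘(ℝ, Fin (n + 1) → ℂ) ∞
      (fun (g : EffTorus n) (k : Fin (n + 1)) => (incl n g k : ℂ)) := by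
  rw [contMDiff_pi_space]
  intro k
  refine Fin.lastCases ?_ (fun i => ?_) k
  · simp only [incl_last]
    exact contMDiff_const
  · simp only [incl_castSucc]
    exact contMDiff_coe_apply i

theorem contMDiff_toMatrix : ContMDiff (torusModel (Fin n))
    𝓘(ℝ, Matrix (Fin (n + 1)) (Fin (n + 1)) ℂ) ∞ (toMatrix n) :=
  (Matrix.diagonalLinearMap (Fin (n + 1)) ℝ ℂ).toContinuousLinearMap.contMDiff.comp
    contMDiff_coe_incl

theorem mdifferentiableAt_toMatrix (g : EffTorus n) :
    MDifferentiableAt (torusModel (Fin n)) 𝓘(ℝ, Matrix (Fin (n + 1)) (Fin (n + 1)) ℂ)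
      (toMatrix n) g :=
  (contMDiff_toMatrix g).mdifferentiableAt (by simp)

/-- The Lie algebra element `v` as the matrix `diag(i θ_1, …, i θ_n, 0)`. -/
def lieMatrix (v : GroupLieAlgebra (torusModel (Fin n)) (EffTorus n)) :
    Matrix (Fin (n + 1)) (Fin (n + 1)) ℂ :=
  Matrix.diagonal (Fin.snoc (α := fun _ => ℂ) (fun k => Complex.I * ((angle k v : ℝ) : ℂ)) 0)

theorem conjTranspose_lieMatrix (v : GroupLieAlgebra (torusModel (Fin n)) (EffTorus n)) :
    (lieMatrix v)ᴴ = -lieMatrix v := by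
  rw [lieMatrix, Matrix.diagonal_conjTranspose, Matrix.diagonal_neg]
  congr 1
  funext k
  refine Fin.lastCases ?_ (fun i => ?_) k <;> simp

theorem mfderiv_toMatrix (v : GroupLieAlgebra (torusModel (Fin n)) (EffTorus n)) :
    (mfderiv (torusModel (Fin n)) 𝓘(ℝ, Matrix (Fin (n + 1)) (Fin (n + 1)) ℂ) (toMatrix n) 1 v :
      Matrix (Fin (n + 1)) (Fin (n + 1)) ℂ) = lieMatrix v := by
  have hincl := (contMDiff_coe_incl (n := n) 1).mdifferentiableAt (by simp)
  refine (mfderiv_comp_apply_of_hasFDerivAt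
    (Matrix.diagonalLinearMap (Fin (n + 1)) ℝ ℂ).toContinuousLinearMap.hasFDerivAt hincl v).trans ?_
  refine congrArg Matrix.diagonal (funext fun k => ?_)
  have hk := mfderiv_comp_apply_of_hasFDerivAt
    (ContinuousLinearMap.proj (R := ℝ) (φ := fun _ : Fin (n + 1) => ℂ) k).hasFDerivAt hincl v
  refine hk.symm.trans ?_
  refine Fin.lastCases ?_ (fun i => ?_) k
  · have h : (fun g : EffTorus n => (incl n g (Fin.last n) : ℂ)) = fun _ => 1 := by
      funext g
      rw [incl_last, Circle.coe_one]
    rw [Fin.snoc_last]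
    exact (mfderiv_apply_congr h 1 v).trans (mfderiv_const_apply 1 1 v)
  · have h : (fun g : EffTorus n => (incl n g i.castSucc : ℂ)) = fun g => (g i : ℂ) := by
      funext g
      rw [incl_castSucc]
    rw [Fin.snoc_castSucc]
    exact (mfderiv_apply_congr h 1 v).trans (mfderiv_coe_apply_one i v)

end EffTorus

/-! ### The Hamiltonian action -/

section Conjugation

variable {m : Type*} [Fintype m]

theorem contDiff_conjugate [DecidableEq m] {n : WithTop ℕ∞} :
    ContDiff ℝ n (fun p : Matrix m m ℂ × Matrix m m ℂ => p.1 * p.2 * p.1ᴴ) :=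
  contDiffOn_univ.1 (contDiffOn_matrix_mul
    (contDiffOn_matrix_mul contDiffOn_fst contDiffOn_snd)
    (contDiffOn_matrix_conjTranspose contDiffOn_fst))

theorem differentiable_conjugate (ξ : Matrix m m ℂ) :
    Differentiable ℝ (fun D : Matrix m m ℂ => D * ξ * Dᴴ) := by
  classical
  exact ((contDiff_conjugate (n := 1)).comp
    (contDiff_id.prodMk contDiff_const)).differentiable one_ne_zero

theorem fderiv_conjugate_one [DecidableEq m] (ξ X : Matrix m m ℂ) :
    fderiv ℝ (fun D : Matrix m m ℂ => D * ξ * Dᴴ) 1 X = X * ξ + ξ * Xᴴ := by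
  refine fderiv_apply_eq_of_hasLineDerivAt (differentiable_conjugate ξ 1) ?_
  have hX := hasLineDerivAt_id 1 X
  refine (hasDerivAt_matrix_mul (hasDerivAt_matrix_mul hX (hasDerivAt_const (0 : ℝ) ξ))
    (hasDerivAt_matrix_conjTranspose hX)).congr_deriv ?_
  simp

end Conjugation

namespace EffTorus

variable {d n : ℕ}

/-- The component of the momentum map along `v`, extended to a linear function of the matrix. -/
def momentumCLM (v : GroupLieAlgebra (torusModel (Fin n)) (EffTorus n)) :
    Matrix (Fin (n + 1)) (Fin (n + 1)) ℂ →L[ℝ] ℝ :=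
  (1 / 2 : ℝ) • ∑ k : Fin n, angle k v • (Complex.reCLM ∘L
    (Matrix.entryLinearMap ℝ ℂ k.castSucc k.castSucc).toContinuousLinearMap)

theorem momentumCLM_apply (v : GroupLieAlgebra (torusModel (Fin n)) (EffTorus n))
    (X : Matrix (Fin (n + 1)) (Fin (n + 1)) ℂ) :
    momentumCLM v X = 1 / 2 * ∑ k : Fin n, (X k.castSucc k.castSucc).re * angle k v := by
  simp [momentumCLM, mul_comm]

theorem dualOfCoords_momentum (v : GroupLieAlgebra (torusModel (Fin n)) (EffTorus n)) :
    (fun ξ : Orbit d (n + 1) => dualOfCoords n ξ.momentum v) = fun ξ => momentumCLM v ξ.incl := by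
  funext ξ
  rw [dualOfCoords_apply, momentumCLM_apply]
  rfl

theorem re_trace_lieMatrix_mul (v : GroupLieAlgebra (torusModel (Fin n)) (EffTorus n))
    (X : Matrix (Fin (n + 1)) (Fin (n + 1)) ℂ) :
    (-(Complex.I / 2) * (lieMatrix v * X).trace).re = momentumCLM v X := by
  have hentry (θ : ℝ) (z : ℂ) :
      (-(Complex.I / 2) * (Complex.I * θ * z)).re = 1 / 2 * (z.re * θ) := by
    rw [show -(Complex.I / 2) * (Complex.I * θ * z) =
      -(Complex.I * Complex.I) * (((1 / 2 * θ : ℝ) : ℂ) * z) by push_cast; ring,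
      Complex.I_mul_I, neg_neg, one_mul, Complex.re_ofReal_mul]
    ring
  simp only [momentumCLM_apply, Matrix.trace, Matrix.diag_apply, lieMatrix, Matrix.diagonal_mul,
    Fin.sum_univ_castSucc, Fin.snoc_castSucc, Fin.snoc_last, zero_mul, add_zero, Finset.mul_sum,
    Complex.re_sum, hentry]

variable [hd : Fact (0 < d)] [hN : Fact (d ≤ n + 1)]

theorem smul_eq (g : EffTorus n) (ξ : Orbit d (n + 1)) :
    g • ξ = torusToUnitary (n + 1) (incl n g) • ξ := rfl

theorem faithfulSMul (hdn : d < n + 1) : FaithfulSMul (EffTorus n) (Orbit d (n + 1)) where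
  eq_of_smul_eq_smul {g h} hgh := by
    funext k
    obtain ⟨ξ, hξ⟩ := Orbit.exists_incl_apply_ne_zero (d := d) hdn (Fin.castSucc_lt_last k).ne
    have hentry := congrArg (fun ζ : Orbit d (n + 1) => ζ.incl k.castSucc (Fin.last n)) (hgh ξ)
    simp only [smul_eq, Orbit.torus_smul_apply, incl_castSucc, incl_last, Circle.coe_one, star_one,
      mul_one] at hentry
    exact Circle.ext (mul_right_cancel₀ hξ hentry)

instance contMDiffSMul :
    ContMDiffSMul (torusModel (Fin n)) 𝓘(ℝ, OrbitModel d (n + 1)) ∞ (EffTorus n)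
      (Orbit d (n + 1)) where
  contMDiff_smul := by
    have hD := contMDiff_toMatrix (n := n).comp (contMDiff_fst (I := torusModel (Fin n))
      (J := 𝓘(ℝ, OrbitModel d (n + 1))) (M := EffTorus n) (N := Orbit d (n + 1)))
    have hξ := (Orbit.contMDiff_incl (d := d) (N := n + 1) (n := ∞)).comp
      (contMDiff_snd (I := torusModel (Fin n)) (J := 𝓘(ℝ, OrbitModel d (n + 1)))
        (M := EffTorus n) (N := Orbit d (n + 1)))
    have hconj := (contDiff_conjugate (m := Fin (n + 1)) (n := ∞)).contMDiff
    have hsmul := hconj.comp (hD.prodMk_space hξ)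
    exact Orbit.contMDiff_of_incl_comp hsmul

theorem mdifferentiableAt_smul_const (g : EffTorus n) (ξ : Orbit d (n + 1)) :
    MDifferentiableAt (torusModel (Fin n)) 𝓘(ℝ, OrbitModel d (n + 1))
      (fun g : EffTorus n => g • ξ) g :=
  (contMDiff_id.smul contMDiff_const g).mdifferentiableAt (n := ∞) (by simp)

theorem tangentIncl_fundamentalField (v : GroupLieAlgebra (torusModel (Fin n)) (EffTorus n))
    (ξ : Orbit d (n + 1)) :
    ξ.tangentIncl (fundamentalField (torusModel (Fin n)) v ξ) = ⁅lieMatrix v, ξ.incl⁆ := by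
  have hconj : HasFDerivAt (fun D => D * ξ.incl * Dᴴ)
      (fderiv ℝ (fun D => D * ξ.incl * Dᴴ) 1) (toMatrix n 1) := by
    rw [toMatrix_one]
    exact (differentiable_conjugate ξ.incl 1).hasFDerivAt
  have hchain := mfderiv_comp_apply_of_hasFDerivAt hconj (mdifferentiableAt_toMatrix 1) v
  rw [mfderiv_toMatrix, fderiv_conjugate_one, conjTranspose_lieMatrix,
    Matrix.mul_neg, ← sub_eq_add_neg] at hchain
  exact (mfderiv_comp_apply_of_eq (x := (1 : EffTorus n)) (Orbit.mdifferentiableAt_incl ξ)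
    (mdifferentiableAt_smul_const 1 ξ) (one_smul _ ξ) v).symm.trans hchain

theorem kksForm_fundamentalField (v : GroupLieAlgebra (torusModel (Fin n)) (EffTorus n))
    (ξ : Orbit d (n + 1)) (Y : TangentSpace 𝓘(ℝ, OrbitModel d (n + 1)) ξ) :
    Orbit.kksForm d (n + 1) ξ ![fundamentalField (torusModel (Fin n)) v ξ, Y] =
      momentumCLM v (ξ.tangentIncl Y) := by
  obtain ⟨η, hη, hY⟩ := ξ.exists_lie_eq_tangentIncl Y
  rw [Orbit.kksForm_eq_alphaPairing ξ _ Y _ _ (conjTranspose_lieMatrix v) hη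
    (tangentIncl_fundamentalField v ξ) hY, alphaPairing_lie _ (conjTranspose_lieMatrix v) hη, ← hY,
    re_trace_lieMatrix_mul]

theorem momentum_smul (g : EffTorus n) (ξ : Orbit d (n + 1)) :
    (g • ξ).momentum = ξ.momentum := by
  funext k
  simp only [Orbit.momentum, smul_eq, Orbit.torus_smul_apply]
  rw [mul_right_comm, circle_coe_mul_star_coe, one_mul]

theorem isHamiltonianAction :
    IsHamiltonianAction (torusModel (Fin n)) (Orbit.kksForm d (n + 1))
      (fun ξ : Orbit d (n + 1) => dualOfCoords n ξ.momentum) where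
  isSymplectic := Orbit.isSymplectic_kksForm
  smooth_smul := contMDiffSMul
  invariant g := Orbit.kksForm_unitary_smul (torusToUnitary (n + 1) (incl n g))
  smooth_momentum v := by
    rw [dualOfCoords_momentum]
    exact (momentumCLM v).contMDiff.comp Orbit.contMDiff_incl
  hamilton v ξ Y := (kksForm_fundamentalField v ξ Y).trans
    ((mfderiv_apply_congr (dualOfCoords_momentum v) ξ Y).trans
      (Orbit.mfderiv_clm_comp_incl (momentumCLM v) ξ Y)).symm
  equivariant g ξ v := by rw [momentum_smul, lieAd_eq_self]

end EffTorus

end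

theorem mainTheorem7 (n d : ℕ) [Fact (0 < d)] [Fact (d ≤ n + 1)] :
    -- `𝒪_{N/d}`, `N = n + 1`, is a coadjoint orbit of `U(N)`, and `𝒪_{N/d} ≈ ℱ_{N/d} / U(d)`
    IsCoadjointOrbit d (n + 1) ∧
    GramIsSymplectomorphism d (n + 1) ∧
    -- `G` is `U(1)^N / U(1)`, the scalars act trivially, the action of `G` is effective if `d < N`
    Function.Bijective (fun g : EffTorus n =>
      (QuotientGroup.mk (EffTorus.incl n g) : (Fin (n + 1) → Circle) ⧸ scalarTorus (n + 1))) ∧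
    (∀ g ∈ scalarTorus (n + 1), ∀ ξ : Orbit d (n + 1), torusToUnitary (n + 1) g • ξ = ξ) ∧
    (d < n + 1 → FaithfulSMul (EffTorus n) (Orbit d (n + 1))) ∧
    -- `ℝ^{N-1} ≈ 𝔤*`
    Function.Bijective (EffTorus.dualOfCoords n) ∧
    -- the action is Hamiltonian with momentum map `Φ_G`
    IsHamiltonianAction (torusModel (Fin n)) (Orbit.kksForm d (n + 1))
      (fun ξ : Orbit d (n + 1) => EffTorus.dualOfCoords n ξ.momentum) ∧
    -- and `Φ_G (Fᴴ F) = (‖f_1‖², …, ‖f_{N-1}‖²)`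
    ∀ (F : TightFrame d (n + 1)) (k : Fin n),
      F.gram.momentum k = ‖WithLp.toLp 2 (fun i => F.mat i k.castSucc)‖ ^ 2 :=
  ⟨isCoadjointOrbit d (n + 1), TightFrame.gramIsSymplectomorphism, EffTorus.mk_incl_bijective,
    Orbit.scalarTorus_smul, EffTorus.faithfulSMul, EffTorus.dualOfCoords_bijective,
    EffTorus.isHamiltonianAction, TightFrame.momentum_gram⟩
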